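/- Let $\mathbb C^+$ be the open upper half-plane. For a probability measure $\mu\neq\delta_0$ on $[0,+\infty)$ put $$\psi_\mu(z)=\int_{[0,+\infty)}\frac{zs}{1-zs}\,d\mu(s),\qquad \eta_\mu(z)=\frac{\psi_\mu(z)}{1+\psi_\mu(z)},\qquad z\in\mathbb C\setminus[0,+\infty).$$ The function $\eta_\mu$ maps $(-\infty,0)$ injectively into $(-\infty,0)$; let $\eta_\mu^{-1}$ be the inverse of this restriction, and let $\Sigma_\mu(z)=\eta_\mu^{-1}(z)/z>0$ for $z\in\eta_\mu((-\infty,0))$. **Theorem.** Let $\mu\neq\delta_0$ be a probability measure on $[0,+\infty)$ and let $t\geq 1$ be a real number. There are a probability measure $\mu_t$ on $[0,+\infty)$ and a function $\omega_t$ on $\mathbb C\setminus[0,+\infty)$ with the following properties. 1. $\mu_t\neq\delta_0$, and for all $z<0$ sufficiently close to zero, $\Sigma_\mu(z)$ and $\Sigma_{\mu_t}(z)$ are defined and $\Sigma_{\mu_t}(z)=\Sigma_\mu(z)^t$. 2. $\omega_t$ is an analytic map of $\mathbb C\setminus[0,+\infty)$ into itself with $\omega_t((-\infty,0))\subset(-\infty,0)$,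 $\lim_{x\uparrow 0}\omega_t(x)=0$, $\arg\omega_t(z)\in[\arg z,\pi)$ for all $z\in\mathbb C^+$, and $\eta_{\mu_t}(z)=\eta_\mu(\omega_t(z))$ for all $z\in\mathbb C\setminus[0,+\infty)$. 3. For all $z\in\mathbb C\setminus[0,+\infty)$, $$\omega_t(z)=\eta_{\mu_t}(z)\left[\frac{z}{\eta_{\mu_t}(z)}\right]^{1/t},$$ where the power is the analytic branch on $\mathbb C\setminus[0,+\infty)$ that is positive for $z<0$. 4. The function $$\Phi_t(z)=z\left[\frac{z}{\eta_\mu(z)}\right]^{t-1},\qquad z\in\mathbb C\setminus[0,+\infty),$$ with the same convention for the power, is well defined, analytic and without zeros, and $\Phi_t(\omega_t(z))=z$ for all $z\in\mathbb C\setminus[0,+\infty)$. -/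

import Mathlib

open Set Filter Topology MeasureTheory
open scoped NNReal

noncomputable section

/-- The slit complex plane `ℂ ∖ [0, +∞)`. -/
def slitDomain : Set ℂ := {z : ℂ | ¬ (0 ≤ z.re ∧ z.im = 0)}

/-- The moment generating function `ψ_μ(z) = ∫ zs / (1 - zs) dμ(s)` of a measure `μ` on `[0, +∞)`.
For finite `μ` and `z` in the slit plane the integrand is bounded and continuous, so the integral
converges. -/
def psiTransform (μ : Measure ℝ≥0) (z : ℂ) : ℂ :=
  ∫ s : ℝ≥0, z * ((s : ℝ) : ℂ) / (1 - z * ((s : ℝ) : ℂ)) ∂μ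

/-- The function `η_μ = ψ_μ / (1 + ψ_μ)`. -/
def etaTransform (μ : Measure ℝ≥0) (z : ℂ) : ℂ :=
  psiTransform μ z / (1 + psiTransform μ z)

/-- The image `η_μ((-∞, 0))`, as a set of real numbers: the real points at which the inverse of
`η_μ` restricted to `(-∞, 0)` is defined. -/
def etaRange (μ : Measure ℝ≥0) : Set ℝ :=
  {y : ℝ | ∃ x : ℝ, x < 0 ∧ etaTransform μ (x : ℂ) = (y : ℂ)}

/-- The inverse of the (injective, for a probability measure `μ ≠ δ₀`) restriction of `η_μ` to
`(-∞, 0)`; it is meaningful on `etaRange μ`. -/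
def etaInv (μ : Measure ℝ≥0) (y : ℝ) : ℝ :=
  Function.invFunOn (fun x : ℝ => etaTransform μ (x : ℂ)) (Set.Iio 0) (y : ℂ)

/-- The function `Σ_μ(y) = η_μ⁻¹(y) / y` on `etaRange μ`. -/
def SigmaTransform (μ : Measure ℝ≥0) (y : ℝ) : ℝ := etaInv μ y / y

/-- `p` is, on the slit plane, the power `h ^ s` that is positive on `(-∞, 0)`:
`p = exp (s * L)`, where `L` is the analytic logarithm of `h` on `ℂ ∖ [0, +∞)` that is real on
`(-∞, 0)`. As the slit plane is connected, `h` has at most one such logarithm, and so `p` is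
determined there by `h` and `s`. In particular `h` is required not to vanish. -/
def IsPositivePower (h : ℂ → ℂ) (s : ℝ) (p : ℂ → ℂ) : Prop :=
  ∃ L : ℂ → ℂ, AnalyticOnNhd ℂ L slitDomain ∧
    (∀ z ∈ slitDomain, Complex.exp (L z) = h z) ∧
    (∀ x : ℝ, x < 0 → (L (x : ℂ)).im = 0) ∧
    ∀ z ∈ slitDomain, p z = Complex.exp ((s : ℂ) * L z)

end

/-! In the coordinate z = -exp ζ the slit plane becomes the strip |Im ζ| < π, and every power in the
theorem is the exponential of a combination of values of the principal logarithm log(-·). Let h be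
η_μ in this coordinate (`logEta`) and c = 1 - 1/t, so 0 ≤ c < 1. The equation Φ_t(ω) = z turns into
the fixed point equation W = (1 - c) ζ + c h(W).

Since h maps the strip into itself, Schwarz–Pick (`norm_deriv_mul_cos_le`) says that it does not
expand the hyperbolic metric |dζ| / cos(Im ζ / 2). Averaging with a fixed point ζ of the strip makes
the map a strict contraction, by concavity of the cosine (`mul_cos_le_of_average`). The iterates
started at ζ therefore converge locally uniformly to a holomorphic W
(`exists_fixedPoint_averagedMap`), and ω(z) = -exp W(log(-z)).

It remains to see that g = η_μ ∘ ω is the η-transform of a measure. For η_μ itself, Cauchy–Schwarz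
gives arg η_μ(z) ≥ arg z on the upper half-plane (`etaTransform_mul_conj_im_nonneg`); this bound
passes through the iteration to ω and then to g. Conversely it implies Re(m / (1 - g(-m²))) ≥ 0 for
Re m > 0, and Herglotz's theorem converts this positivity into 1 / (1 - g(z)) = ∫ 1 / (1 - zs) dν(s)
with a probability measure ν (`exists_probabilityMeasure_geomTransform`). Then μ_t = ν. The
Σ-identity and the formulas for ω_t and Φ_t are all the one equation t log(-ω) = log(-z) + (t - 1)
log(-η_μ(ω)). -/

/-! ### The slit plane and the kernel 1 - zs -/

theorem mem_slitDomain_iff {z : ℂ} : z ∈ slitDomain ↔ -z ∈ Complex.slitPlane := by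
  simp only [slitDomain, mem_ofPred_eq, Complex.mem_slitPlane_iff, Complex.neg_re, Complex.neg_im,
    not_and_or, not_le, ne_eq, neg_eq_zero, Left.neg_pos_iff]

theorem isOpen_slitDomain : IsOpen slitDomain := by
  have : slitDomain = (fun z : ℂ => -z) ⁻¹' Complex.slitPlane := by
    ext z; exact mem_slitDomain_iff
  rw [this]
  exact Complex.isOpen_slitPlane.preimage continuous_neg

theorem mem_slitDomain_of_im_ne_zero {z : ℂ} (hz : z.im ≠ 0) : z ∈ slitDomain :=
  fun h => hz h.2

theorem ofReal_mem_slitDomain {x : ℝ} (hx : x < 0) : (x : ℂ) ∈ slitDomain :=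
  fun h => absurd h.1 (by simpa using hx)

theorem conj_mem_slitDomain {z : ℂ} (hz : z ∈ slitDomain) :
    (starRingEnd ℂ) z ∈ slitDomain := by
  intro h
  exact hz ⟨by simpa using h.1, by simpa using h.2⟩

theorem ne_zero_of_mem_slitDomain {z : ℂ} (hz : z ∈ slitDomain) : z ≠ 0 := by
  rintro rfl; exact hz (by simp)

theorem slitDomain_cases {z : ℂ} (hz : z ∈ slitDomain) :
    0 < z.im ∨ z.im < 0 ∨ ∃ x : ℝ, x < 0 ∧ z = x := by
  rcases lt_trichotomy z.im 0 with h | h | h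
  · exact Or.inr (Or.inl h)
  · refine Or.inr (Or.inr ⟨z.re, ?_, Complex.ext rfl (by simp [h])⟩)
    by_contra hc
    exact hz ⟨not_lt.1 hc, h⟩
  · exact Or.inl h

/-- Away from the slit, `1 - z s` grows at least linearly in `s`, locally uniformly in `z`. -/
theorem exists_lower_bound_one_sub_mul {z₀ : ℂ} (hz₀ : z₀ ∈ slitDomain) :
    ∃ δ > 0, ∀ z ∈ Metric.ball z₀ δ, ∀ s : ℝ≥0, δ * (1 + (s : ℝ)) ≤ ‖1 - z * ((s : ℝ) : ℂ)‖ := by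
  -- With r = s / (1 + s), the quotient (1 - z₀ s) / (1 + s) is (1 - r) - z₀ r. This is continuous
  -- on the compact interval [0, 1] and has no zero there, so its minimum modulus is a bound uniform
  -- in s.
  have hcont : ContinuousOn (fun r : ℝ => ‖(1 - r : ℂ) - z₀ * r‖) (Icc 0 1) := by fun_prop
  obtain ⟨r₀, hr₀, hmin⟩ := isCompact_Icc.exists_isMinOn (nonempty_Icc.2 zero_le_one) hcont
  have hpos : 0 < ‖(1 - r₀ : ℂ) - z₀ * r₀‖ := by
    rw [norm_pos_iff]
    intro h0
    have hre := congrArg Complex.re h0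
    have him := congrArg Complex.im h0
    simp only [Complex.sub_re, Complex.one_re, Complex.ofReal_re, Complex.mul_re,
      Complex.ofReal_im, mul_zero, sub_zero, Complex.zero_re, Complex.sub_im, Complex.one_im,
      Complex.mul_im, zero_add, zero_sub, Complex.zero_im, neg_eq_zero, mul_eq_zero] at hre him
    rcases him with him | him
    · refine hz₀ ⟨?_, him⟩
      by_contra hc
      push Not at hc
      nlinarith [hr₀.1, hr₀.2, mul_nonneg hr₀.1 (neg_pos.2 hc).le]
    · rw [him] at hre; norm_num at hre
  set m := ‖(1 - r₀ : ℂ) - z₀ * r₀‖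
  have key : ∀ s : ℝ≥0, m * (1 + (s : ℝ)) ≤ ‖1 - z₀ * ((s : ℝ) : ℂ)‖ := by
    intro s
    have hs : (0 : ℝ) < 1 + s := by positivity
    have hr : (s : ℝ) / (1 + s) ∈ Icc (0 : ℝ) 1 :=
      ⟨by positivity, (div_le_one hs).2 (by linarith)⟩
    have h := hmin hr
    simp only [mem_ofPred_eq] at h
    have hsC : (1 + ((s : ℝ) : ℂ)) ≠ 0 := by exact_mod_cast hs.ne'
    have e : (1 - ((s : ℝ) / (1 + s) : ℝ) : ℂ) - z₀ * ((s : ℝ) / (1 + s) : ℝ)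
        = (1 - z₀ * ((s : ℝ) : ℂ)) / ((1 + s : ℝ) : ℂ) := by
      push_cast
      field_simp
      ring
    rw [e, norm_div, Complex.norm_real, Real.norm_of_nonneg hs.le, le_div_iff₀ hs] at h
    exact h
  refine ⟨m / 2, by positivity, fun z hz s => ?_⟩
  have h1 : ‖1 - z₀ * ((s : ℝ) : ℂ)‖ ≤ ‖1 - z * ((s : ℝ) : ℂ)‖ + ‖z - z₀‖ * s := by
    have : 1 - z₀ * ((s : ℝ) : ℂ) = (1 - z * ((s : ℝ) : ℂ)) + (z - z₀) * ((s : ℝ) : ℂ) := by ring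
    rw [this]
    refine (norm_add_le _ _).trans ?_
    rw [norm_mul, Complex.norm_real, Real.norm_of_nonneg s.coe_nonneg]
  rw [Metric.mem_ball, dist_eq_norm] at hz
  nlinarith [key s, s.coe_nonneg, mul_le_mul_of_nonneg_right hz.le s.coe_nonneg]

theorem one_sub_mul_ne_zero {z : ℂ} (hz : z ∈ slitDomain) (s : ℝ≥0) :
    1 - z * ((s : ℝ) : ℂ) ≠ 0 := by
  obtain ⟨δ, hδ, h⟩ := exists_lower_bound_one_sub_mul hz
  rw [← norm_pos_iff]
  exact lt_of_lt_of_le (by positivity) (h z (Metric.mem_ball_self hδ) s)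

/-! ### The transform 1 + ψ_μ and its weighted moments -/

/-- The transform `∫ 1 / (1 - z s) dμ(s)`, which is `1 + ψ_μ(z)` for a probability measure. -/
noncomputable def geomTransform (μ : Measure ℝ≥0) (z : ℂ) : ℂ :=
  ∫ s : ℝ≥0, (1 - z * ((s : ℝ) : ℂ))⁻¹ ∂μ

section
variable {μ : Measure ℝ≥0} [IsFiniteMeasure μ]

theorem integrable_inv_one_sub_mul {z : ℂ} (hz : z ∈ slitDomain) :
    Integrable (fun s : ℝ≥0 => (1 - z * ((s : ℝ) : ℂ))⁻¹) μ := by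
  obtain ⟨δ, hδ, h⟩ := exists_lower_bound_one_sub_mul hz
  refine Integrable.of_bound (C := δ⁻¹) ?_ (ae_of_all _ fun s => ?_)
  · exact (by fun_prop : Measurable fun s : ℝ≥0 => (1 - z * ((s : ℝ) : ℂ))⁻¹).aestronglyMeasurable
  · rw [norm_inv]
    refine inv_anti₀ hδ ((le_mul_of_one_le_right hδ.le ?_).trans (h z (Metric.mem_ball_self hδ) s))
    simp

theorem differentiableOn_geomTransform : DifferentiableOn ℂ (geomTransform μ) slitDomain := by
  intro z₀ hz₀
  obtain ⟨δ, hδ, h⟩ := exists_lower_bound_one_sub_mul hz₀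
  have hne : ∀ z ∈ Metric.ball z₀ δ, ∀ s : ℝ≥0, 1 - z * ((s : ℝ) : ℂ) ≠ 0 := fun z hz s => by
    rw [← norm_pos_iff]
    exact lt_of_lt_of_le (by positivity) (h z hz s)
  refine (hasDerivAt_integral_of_dominated_loc_of_deriv_le (bound := fun _ => (δ ^ 2)⁻¹)
    (F := fun (z : ℂ) (s : ℝ≥0) => (1 - z * ((s : ℝ) : ℂ))⁻¹)
    (F' := fun z s => ((s : ℝ) : ℂ) / (1 - z * ((s : ℝ) : ℂ)) ^ 2)
    (Metric.ball_mem_nhds z₀ hδ) ?_ (integrable_inv_one_sub_mul hz₀) ?_ ?_ (integrable_const _)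
    ?_).2.differentiableAt.differentiableWithinAt
  · refine Eventually.of_forall fun z => ?_
    exact (by fun_prop :
      Measurable fun s : ℝ≥0 => (1 - z * ((s : ℝ) : ℂ))⁻¹).aestronglyMeasurable
  · exact (by fun_prop :
      Measurable fun s : ℝ≥0 => ((s : ℝ) : ℂ) / (1 - z₀ * ((s : ℝ) : ℂ)) ^ 2).aestronglyMeasurable
  · refine ae_of_all _ fun s z hz => ?_
    have hs : (0 : ℝ) ≤ s := s.coe_nonneg
    rw [norm_div, norm_pow, Complex.norm_real, Real.norm_of_nonneg hs, div_le_iff₀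
      (pow_pos (norm_pos_iff.2 (hne z hz s)) 2), inv_mul_eq_div, le_div_iff₀ (by positivity)]
    have h2 := pow_le_pow_left₀ (by positivity) (h z hz s) 2
    have : (s : ℝ) * δ ^ 2 ≤ (δ * (1 + s)) ^ 2 := by
      rw [mul_pow, mul_comm]
      exact mul_le_mul_of_nonneg_left (by nlinarith) (by positivity)
    linarith
  · refine ae_of_all _ fun s z hz => ?_
    have h1 : HasDerivAt (fun z : ℂ => 1 - z * ((s : ℝ) : ℂ)) (-((s : ℝ) : ℂ)) z := by
      simpa using ((hasDerivAt_id z).mul_const ((s : ℝ) : ℂ)).const_sub 1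
    simpa using h1.fun_inv (hne z hz s)

omit [IsFiniteMeasure μ] in
theorem geomTransform_conj (z : ℂ) :
    geomTransform μ ((starRingEnd ℂ) z) = (starRingEnd ℂ) (geomTransform μ z) := by
  rw [geomTransform, geomTransform, ← integral_conj]
  simp

/-- The moments `∫ sᵏ / |1 - z s|² dμ(s)`. -/
noncomputable def weightedMoment (μ : Measure ℝ≥0) (k : ℕ) (z : ℂ) : ℝ :=
  ∫ s : ℝ≥0, (s : ℝ) ^ k / Complex.normSq (1 - z * ((s : ℝ) : ℂ)) ∂μ

theorem integrable_weightedMoment {z : ℂ} (hz : z ∈ slitDomain) {k : ℕ} (hk : k ≤ 2) :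
    Integrable (fun s : ℝ≥0 => (s : ℝ) ^ k / Complex.normSq (1 - z * ((s : ℝ) : ℂ))) μ := by
  obtain ⟨δ, hδ, h⟩ := exists_lower_bound_one_sub_mul hz
  refine Integrable.of_bound (C := (δ ^ 2)⁻¹) ?_ (ae_of_all _ fun s => ?_)
  · have : Measurable fun s : ℝ≥0 => (s : ℝ) ^ k / Complex.normSq (1 - z * ((s : ℝ) : ℂ)) := by
      refine Measurable.div (by fun_prop) (Complex.continuous_normSq.measurable.comp (by fun_prop))
    exact this.aestronglyMeasurable
  · have hs : (0 : ℝ) ≤ s := s.coe_nonneg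
    have hN : 0 < Complex.normSq (1 - z * ((s : ℝ) : ℂ)) :=
      Complex.normSq_pos.2 (one_sub_mul_ne_zero hz s)
    rw [Real.norm_of_nonneg (by positivity), div_le_iff₀ hN, inv_mul_eq_div,
      le_div_iff₀ (by positivity), Complex.normSq_eq_norm_sq]
    have h2 := pow_le_pow_left₀ (by positivity) (h z (Metric.mem_ball_self hδ) s) 2
    have h3 : (s : ℝ) ^ k ≤ (1 + s) ^ 2 :=
      (pow_le_pow_left₀ hs (by linarith) k).trans (pow_le_pow_right₀ (by linarith) hk)
    calc (s : ℝ) ^ k * δ ^ 2 ≤ (1 + s) ^ 2 * δ ^ 2 := by gcongr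
      _ = (δ * (1 + s)) ^ 2 := by ring
      _ ≤ _ := h2

theorem geomTransform_re {z : ℂ} (hz : z ∈ slitDomain) :
    (geomTransform μ z).re = weightedMoment μ 0 z - z.re * weightedMoment μ 1 z := by
  have h := integral_re (integrable_inv_one_sub_mul (μ := μ) hz)
  simp only [RCLike.re_eq_complex_re] at h
  rw [geomTransform, ← h, weightedMoment, weightedMoment, ← integral_const_mul, ← integral_sub
    (integrable_weightedMoment hz (by norm_num))
    ((integrable_weightedMoment hz (by norm_num)).const_mul _)]
  refine integral_congr_ae (ae_of_all _ fun s => ?_)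
  simp [Complex.inv_re]
  ring

theorem geomTransform_im {z : ℂ} (hz : z ∈ slitDomain) :
    (geomTransform μ z).im = z.im * weightedMoment μ 1 z := by
  have h := integral_im (integrable_inv_one_sub_mul (μ := μ) hz)
  simp only [RCLike.im_eq_complex_im] at h
  rw [geomTransform, ← h, weightedMoment, ← integral_const_mul]
  refine integral_congr_ae (ae_of_all _ fun s => ?_)
  simp [Complex.inv_im]
  ring

end

section
variable {μ : Measure ℝ≥0} [IsProbabilityMeasure μ]

/-- Integrate |1 - zs|² / |1 - zs|² = 1 after expanding the numerator in powers of s. -/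
theorem weightedMoment_relation {z : ℂ} (hz : z ∈ slitDomain) :
    weightedMoment μ 0 z - 2 * z.re * weightedMoment μ 1 z
      + Complex.normSq z * weightedMoment μ 2 z = 1 := by
  have i0 := integrable_weightedMoment (μ := μ) hz (k := 0) (by norm_num)
  have i1 := integrable_weightedMoment (μ := μ) hz (k := 1) (by norm_num)
  have i2 := integrable_weightedMoment (μ := μ) hz (k := 2) (by norm_num)
  have i01 : Integrable (fun s : ℝ≥0 => (s : ℝ) ^ 0 / Complex.normSq (1 - z * ((s : ℝ) : ℂ))
      - 2 * z.re * ((s : ℝ) ^ 1 / Complex.normSq (1 - z * ((s : ℝ) : ℂ)))) μ :=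
    i0.sub (i1.const_mul _)
  rw [weightedMoment, weightedMoment, weightedMoment, ← integral_const_mul, ← integral_const_mul,
    ← integral_sub i0 (i1.const_mul _), ← integral_add i01 (i2.const_mul _)]
  have : ∀ s : ℝ≥0, ((s : ℝ) ^ 0 / Complex.normSq (1 - z * ((s : ℝ) : ℂ))
      - 2 * z.re * ((s : ℝ) ^ 1 / Complex.normSq (1 - z * ((s : ℝ) : ℂ)))
      + Complex.normSq z * ((s : ℝ) ^ 2 / Complex.normSq (1 - z * ((s : ℝ) : ℂ)))) = 1 := by
    intro s
    have hN := (Complex.normSq_pos.2 (one_sub_mul_ne_zero hz s)).ne'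
    field_simp
    simp [Complex.normSq_apply]
    ring
  rw [integral_congr_ae (ae_of_all _ this)]
  simp

/-- Cauchy–Schwarz: the quadratic polynomial l ↦ ∫ (l - s)² / |1 - zs|² dμ(s) is nonnegative, so its
discriminant is at most 0. -/
theorem weightedMoment_sq_le {z : ℂ} (hz : z ∈ slitDomain) :
    weightedMoment μ 1 z ^ 2 ≤ weightedMoment μ 0 z * weightedMoment μ 2 z := by
  have i0 := integrable_weightedMoment (μ := μ) hz (k := 0) (by norm_num)
  have i1 := integrable_weightedMoment (μ := μ) hz (k := 1) (by norm_num)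
  have i2 := integrable_weightedMoment (μ := μ) hz (k := 2) (by norm_num)
  have key : ∀ l : ℝ, 0 ≤ weightedMoment μ 0 z * (l * l) + (-2 * weightedMoment μ 1 z) * l
      + weightedMoment μ 2 z := by
    intro l
    have : weightedMoment μ 0 z * (l * l) + (-2 * weightedMoment μ 1 z) * l
        + weightedMoment μ 2 z = ∫ s : ℝ≥0, ((l * l) * ((s : ℝ) ^ 0 /
          Complex.normSq (1 - z * ((s : ℝ) : ℂ))) + (-2 * l) * ((s : ℝ) ^ 1 /
          Complex.normSq (1 - z * ((s : ℝ) : ℂ))) + (s : ℝ) ^ 2 /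
          Complex.normSq (1 - z * ((s : ℝ) : ℂ))) ∂μ := by
      rw [integral_add ((i0.const_mul _).fun_add (i1.const_mul _)) i2,
        integral_add (i0.const_mul _) (i1.const_mul _), integral_const_mul, integral_const_mul]
      simp only [weightedMoment]
      ring
    rw [this]
    refine integral_nonneg fun s => ?_
    have hN := Complex.normSq_nonneg (1 - z * ((s : ℝ) : ℂ))
    have e : ((l * l) * ((s : ℝ) ^ 0 / Complex.normSq (1 - z * ((s : ℝ) : ℂ)))
        + (-2 * l) * ((s : ℝ) ^ 1 / Complex.normSq (1 - z * ((s : ℝ) : ℂ)))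
        + (s : ℝ) ^ 2 / Complex.normSq (1 - z * ((s : ℝ) : ℂ)))
        = (l - s) ^ 2 / Complex.normSq (1 - z * ((s : ℝ) : ℂ)) := by ring
    simp only [Pi.zero_apply]
    rw [e]
    positivity
  have := discrim_le_zero key
  rw [discrim] at this
  nlinarith

theorem not_ae_eq_zero_of_ne_dirac (hμ : μ ≠ Measure.dirac 0) : ¬ ∀ᵐ s ∂μ, s = 0 := by
  intro h
  classical
  refine hμ ?_
  ext t ht
  have : (t : Set ℝ≥0) =ᵐ[μ] (if (0 : ℝ≥0) ∈ t then univ else ∅ : Set ℝ≥0) := by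
    filter_upwards [h] with s hs
    subst hs
    split_ifs with h0
    · exact eq_true h0
    · exact eq_false h0
  rw [measure_congr this, Measure.dirac_apply' _ ht]
  by_cases h0 : (0 : ℝ≥0) ∈ t <;> simp [h0]

theorem weightedMoment_one_pos (hμ : μ ≠ Measure.dirac 0) {z : ℂ} (hz : z ∈ slitDomain) :
    0 < weightedMoment μ 1 z := by
  have hN : ∀ s : ℝ≥0, 0 < Complex.normSq (1 - z * ((s : ℝ) : ℂ)) := fun s =>
    Complex.normSq_pos.2 (one_sub_mul_ne_zero hz s)
  have h0 : 0 ≤ᵐ[μ] fun s : ℝ≥0 => (s : ℝ) ^ 1 / Complex.normSq (1 - z * ((s : ℝ) : ℂ)) :=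
    ae_of_all _ fun s => div_nonneg (by simp) (hN s).le
  refine lt_of_le_of_ne (integral_nonneg_of_ae h0) fun h => ?_
  rw [weightedMoment, eq_comm, integral_eq_zero_iff_of_nonneg_ae h0
    (integrable_weightedMoment hz (by norm_num))] at h
  refine not_ae_eq_zero_of_ne_dirac hμ (h.mono fun s hs => ?_)
  simpa [(hN s).ne'] using hs

omit [IsProbabilityMeasure μ] in
theorem weightedMoment_nonneg (k : ℕ) (z : ℂ) : 0 ≤ weightedMoment μ k z :=
  integral_nonneg fun s => div_nonneg (by positivity) (Complex.normSq_nonneg _)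

/-- The imaginary part is Im z times a positive moment, so a zero could only lie on (-∞, 0); there
both terms of the real part are nonnegative and the second is positive. -/
theorem geomTransform_ne_zero (hμ : μ ≠ Measure.dirac 0) {z : ℂ} (hz : z ∈ slitDomain) :
    geomTransform μ z ≠ 0 := by
  intro h
  have hre := geomTransform_re (μ := μ) hz
  have him := geomTransform_im (μ := μ) hz
  have hb := weightedMoment_one_pos hμ hz
  rw [h, Complex.zero_re] at hre
  rw [h, Complex.zero_im, eq_comm, mul_eq_zero] at him
  have hy : z.im = 0 := him.resolve_right hb.ne'
  have hx : z.re < 0 := by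
    by_contra hc
    exact hz ⟨not_lt.1 hc, hy⟩
  nlinarith [weightedMoment_nonneg (μ := μ) 0 z]

/-! ### The function η_μ: argument bound and behaviour on (-∞, 0) -/

theorem one_add_psiTransform {z : ℂ} (hz : z ∈ slitDomain) :
    1 + psiTransform μ z = geomTransform μ z := by
  have : psiTransform μ z = ∫ s : ℝ≥0, ((1 - z * ((s : ℝ) : ℂ))⁻¹ - 1) ∂μ := by
    refine integral_congr_ae (ae_of_all _ fun s => ?_)
    have := one_sub_mul_ne_zero hz s
    simp only
    field_simp
    ring
  rw [this, integral_sub (integrable_inv_one_sub_mul hz) (integrable_const _)]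
  simp [geomTransform]

theorem etaTransform_eq (hμ : μ ≠ Measure.dirac 0) {z : ℂ} (hz : z ∈ slitDomain) :
    etaTransform μ z = 1 - (geomTransform μ z)⁻¹ := by
  have h := geomTransform_ne_zero hμ hz
  rw [etaTransform, one_add_psiTransform hz]
  have : psiTransform μ z = geomTransform μ z - 1 := by rw [← one_add_psiTransform hz]; ring
  rw [this]
  field_simp

theorem differentiableOn_etaTransform (hμ : μ ≠ Measure.dirac 0) :
    DifferentiableOn ℂ (etaTransform μ) slitDomain := by
  refine DifferentiableOn.congr (f := fun z => 1 - (geomTransform μ z)⁻¹) ?_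
    fun z hz => etaTransform_eq hμ hz
  exact (differentiableOn_geomTransform.inv fun z hz => geomTransform_ne_zero hμ hz).const_sub 1

theorem etaTransform_conj (hμ : μ ≠ Measure.dirac 0) {z : ℂ} (hz : z ∈ slitDomain) :
    etaTransform μ ((starRingEnd ℂ) z) = (starRingEnd ℂ) (etaTransform μ z) := by
  rw [etaTransform_eq hμ hz, etaTransform_eq hμ (conj_mem_slitDomain hz), geomTransform_conj]
  simp

theorem etaTransform_im_pos (hμ : μ ≠ Measure.dirac 0) {z : ℂ} (hz : 0 < z.im) :
    0 < (etaTransform μ z).im := by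
  have hz' := mem_slitDomain_of_im_ne_zero hz.ne'
  rw [etaTransform_eq hμ hz', Complex.sub_im, Complex.inv_im, Complex.one_im,
    geomTransform_im hz']
  have := weightedMoment_one_pos hμ hz'
  have hN := Complex.normSq_pos.2 (geomTransform_ne_zero hμ hz')
  rw [neg_div, zero_sub, neg_neg]
  positivity

/-- This encodes arg η_μ(z) ≥ arg z. With M₀, M₁, M₂ the weighted moments, the quantity equals Im z
· |z|² (M₀ M₂ - M₁²) / |1 + ψ_μ(z)|², which Cauchy–Schwarz makes nonnegative. -/
theorem etaTransform_mul_conj_im_nonneg (hμ : μ ≠ Measure.dirac 0) {z : ℂ} (hz : 0 < z.im) :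
    0 ≤ (etaTransform μ z * (starRingEnd ℂ) z).im := by
  have hz' := mem_slitDomain_of_im_ne_zero hz.ne'
  have hN := Complex.normSq_pos.2 (geomTransform_ne_zero hμ hz')
  have hre := geomTransform_re (μ := μ) hz'
  have him := geomTransform_im (μ := μ) hz'
  have hrel := weightedMoment_relation (μ := μ) hz'
  have hcs := weightedMoment_sq_le (μ := μ) hz'
  rw [etaTransform_eq hμ hz']
  set A := geomTransform μ z
  set a := weightedMoment μ 0 z
  set b := weightedMoment μ 1 z
  set c := weightedMoment μ 2 z
  have e : ((1 - A⁻¹) * (starRingEnd ℂ) z).im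
      = z.im * Complex.normSq z * (a * c - b ^ 2) / Complex.normSq A := by
    rw [eq_div_iff hN.ne']
    have : ((1 - A⁻¹) * (starRingEnd ℂ) z).im * Complex.normSq A
        = -z.im * Complex.normSq A + (A * z).im := by
      simp only [Complex.mul_im, Complex.sub_re, Complex.sub_im, Complex.inv_re, Complex.inv_im,
        Complex.one_re, Complex.one_im, Complex.conj_re, Complex.conj_im]
      field_simp
      ring
    rw [this, Complex.normSq_apply, Complex.mul_im, hre, him]
    rw [Complex.normSq_apply] at hrel ⊢
    linear_combination (-(z.im * a)) * hrel
  rw [e]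
  have := Complex.normSq_nonneg z
  have : 0 ≤ a * c - b ^ 2 := by linarith
  positivity

theorem exists_geomTransform_ofReal (hμ : μ ≠ Measure.dirac 0) {x : ℝ} (hx : x < 0) :
    ∃ a : ℝ, 0 < a ∧ a < 1 ∧ geomTransform μ x = a := by
  have hz := ofReal_mem_slitDomain hx
  have hre := geomTransform_re (μ := μ) hz
  have him := geomTransform_im (μ := μ) hz
  have hrel := weightedMoment_relation (μ := μ) hz
  have hb := weightedMoment_one_pos hμ hz
  have ha := weightedMoment_nonneg (μ := μ) 0 x
  have hc := weightedMoment_nonneg (μ := μ) 2 x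
  simp only [Complex.ofReal_re, Complex.ofReal_im, Complex.normSq_ofReal, zero_mul] at *
  refine ⟨(geomTransform μ x).re, ?_, ?_, Complex.ext rfl (by simpa using him)⟩
  · rw [hre]; nlinarith
  -- By the moment relation the value M₀ - x M₁ is also 1 + x M₁ - x² M₂, which is below 1 because x
  -- < 0 < M₁.
  · rw [hre]; nlinarith [mul_nonneg (mul_self_nonneg x) hc, mul_pos (neg_pos.2 hx) hb]

theorem exists_etaTransform_ofReal (hμ : μ ≠ Measure.dirac 0) {x : ℝ} (hx : x < 0) :
    ∃ y : ℝ, y < 0 ∧ etaTransform μ x = y := by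
  obtain ⟨a, ha0, ha1, ha⟩ := exists_geomTransform_ofReal hμ hx
  refine ⟨1 - a⁻¹, ?_, ?_⟩
  · rw [sub_neg]; exact (one_lt_inv₀ ha0).2 ha1
  · rw [etaTransform_eq hμ (ofReal_mem_slitDomain hx), ha]; push_cast; rfl

theorem etaTransform_mem_slitDomain (hμ : μ ≠ Measure.dirac 0) {z : ℂ} (hz : z ∈ slitDomain) :
    etaTransform μ z ∈ slitDomain := by
  rcases slitDomain_cases hz with h | h | ⟨x, hx, rfl⟩
  · exact mem_slitDomain_of_im_ne_zero (etaTransform_im_pos hμ h).ne'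
  · have h' : 0 < ((starRingEnd ℂ) z).im := by simpa using h
    have := etaTransform_im_pos hμ h'
    rw [etaTransform_conj hμ hz, Complex.conj_im] at this
    exact mem_slitDomain_of_im_ne_zero (by linarith)
  · obtain ⟨y, hy, h⟩ := exists_etaTransform_ofReal hμ hx
    rw [h]; exact ofReal_mem_slitDomain hy

/-- The difference of the kernels at x and y is (x - y) s / ((1 - xs)(1 - ys)). The factor after x -
y is nonnegative and vanishes only at s = 0, so its integral is zero only for δ₀. -/
theorem injOn_etaTransform (hμ : μ ≠ Measure.dirac 0) :
    InjOn (fun x : ℝ => etaTransform μ (x : ℂ)) (Iio 0) := by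
  intro x hx y hy h
  have hx' := ofReal_mem_slitDomain hx
  have hy' := ofReal_mem_slitDomain hy
  simp only [etaTransform_eq hμ hx', etaTransform_eq hμ hy', sub_right_inj, inv_inj] at h
  by_contra hne
  set g : ℝ≥0 → ℝ := fun s => (s : ℝ) / ((1 - x * s) * (1 - y * s)) with hg
  have px : ∀ s : ℝ≥0, 0 < 1 - x * (s : ℝ) := fun s => by
    nlinarith [s.coe_nonneg, mem_Iio.1 hx, mul_nonneg (neg_nonneg.2 (mem_Iio.1 hx).le) s.coe_nonneg]
  have py : ∀ s : ℝ≥0, 0 < 1 - y * (s : ℝ) := fun s => by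
    nlinarith [s.coe_nonneg, mem_Iio.1 hy, mul_nonneg (neg_nonneg.2 (mem_Iio.1 hy).le) s.coe_nonneg]
  have heq : ∀ s : ℝ≥0, (1 - (x : ℂ) * ((s : ℝ) : ℂ))⁻¹ - (1 - (y : ℂ) * ((s : ℝ) : ℂ))⁻¹
      = (((x - y) * g s : ℝ) : ℂ) := by
    intro s
    have h1 := one_sub_mul_ne_zero hx' s
    have h2 := one_sub_mul_ne_zero hy' s
    simp only [hg]
    push_cast
    rw [inv_sub_inv h1 h2, ← mul_div_assoc]
    congr 1
    ring
  have hint : Integrable (fun s => (x - y) * g s) μ := by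
    have := ((integrable_inv_one_sub_mul (μ := μ) hx').sub (integrable_inv_one_sub_mul hy')).re
    refine this.congr (ae_of_all _ fun s => ?_)
    simp only [Pi.sub_apply, heq]
    exact RCLike.ofReal_re _
  have hint' : Integrable g μ := by
    have := hint.const_mul (x - y)⁻¹
    refine this.congr (ae_of_all _ fun s => ?_)
    have : x - y ≠ 0 := sub_ne_zero.2 hne
    simp only
    field_simp
  have h0 : ∫ s, (x - y) * g s ∂μ = 0 := by
    have : geomTransform μ x - geomTransform μ y = 0 := sub_eq_zero.2 h
    rw [geomTransform, geomTransform, ← integral_sub (integrable_inv_one_sub_mul hx')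
      (integrable_inv_one_sub_mul hy')] at this
    simp only [heq] at this
    rw [integral_complex_ofReal] at this
    exact_mod_cast this
  rw [integral_const_mul, mul_eq_zero] at h0
  have h1 := h0.resolve_left (sub_ne_zero.2 hne)
  have hnn : 0 ≤ᵐ[μ] g := ae_of_all _ fun s =>
    div_nonneg s.coe_nonneg (mul_pos (px s) (py s)).le
  rw [integral_eq_zero_iff_of_nonneg_ae hnn hint'] at h1
  refine not_ae_eq_zero_of_ne_dirac hμ (h1.mono fun s hs => ?_)
  simpa [hg, (px s).ne', (py s).ne'] using hs

theorem tendsto_geomTransform_zero :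
    Tendsto (fun x : ℝ => geomTransform μ (x : ℂ)) (𝓝[<] 0) (𝓝 1) := by
  have : (1 : ℂ) = ∫ _ : ℝ≥0, (1 : ℂ) ∂μ := by simp
  rw [this]
  refine tendsto_integral_filter_of_dominated_convergence (fun _ => 1) ?_ ?_ (integrable_const _) ?_
  · refine Eventually.of_forall fun x => ?_
    exact (by fun_prop :
      Measurable fun s : ℝ≥0 => (1 - (x : ℂ) * ((s : ℝ) : ℂ))⁻¹).aestronglyMeasurable
  · filter_upwards [self_mem_nhdsWithin] with x hx
    refine ae_of_all _ fun s => ?_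
    have : (1 : ℝ) ≤ 1 - x * s := by
      nlinarith [mul_nonneg (neg_nonneg.2 (mem_Iio.1 hx).le) s.coe_nonneg]
    have e : (1 - (x : ℂ) * ((s : ℝ) : ℂ)) = ((1 - x * s : ℝ) : ℂ) := by push_cast; rfl
    rw [e, norm_inv, Complex.norm_real, Real.norm_of_nonneg (by linarith)]
    exact inv_le_one_of_one_le₀ this
  · refine ae_of_all _ fun s => ?_
    have : ContinuousAt (fun x : ℝ => (1 - (x : ℂ) * ((s : ℝ) : ℂ))⁻¹) 0 := by
      refine ContinuousAt.inv₀ (by fun_prop) (by simp)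
    simpa using this.tendsto.mono_left nhdsWithin_le_nhds

theorem tendsto_etaTransform_zero (hμ : μ ≠ Measure.dirac 0) :
    Tendsto (fun x : ℝ => etaTransform μ (x : ℂ)) (𝓝[<] 0) (𝓝 0) := by
  have h := (tendsto_geomTransform_zero (μ := μ)).inv₀ one_ne_zero
  have h' : Tendsto (fun x : ℝ => 1 - (geomTransform μ (x : ℂ))⁻¹) (𝓝[<] 0) (𝓝 0) := by
    simpa using h.const_sub 1
  refine h'.congr' ?_
  filter_upwards [self_mem_nhdsWithin] with x hx
  exact (etaTransform_eq hμ (ofReal_mem_slitDomain hx)).symm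

end

/-! ### The strip |Im ζ| < π and its hyperbolic metric -/

/-- The strip `{|Im ζ| < π}`. -/
def logStrip : Set ℂ := {ζ : ℂ | |ζ.im| < Real.pi}

theorem isOpen_logStrip : IsOpen logStrip :=
  isOpen_lt (continuous_abs.comp Complex.continuous_im) continuous_const

theorem cos_half_im_pos {ζ : ℂ} (hζ : ζ ∈ logStrip) : 0 < Real.cos (ζ.im / 2) := by
  have := abs_lt.1 (show |ζ.im| < Real.pi from hζ)
  exact Real.cos_pos_of_mem_Ioo ⟨by linarith, by linarith⟩

theorem exp_half_re_pos {ζ : ℂ} (hζ : ζ ∈ logStrip) : 0 < (Complex.exp (ζ / 2)).re := by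
  rw [Complex.exp_re]
  have : (ζ / 2).im = ζ.im / 2 := by simp
  rw [this]
  exact mul_pos (Real.exp_pos _) (cos_half_im_pos hζ)

theorem two_mul_log_mem_logStrip {m : ℂ} (hm : 0 < m.re) : 2 * Complex.log m ∈ logStrip := by
  have h : |m.arg| < Real.pi / 2 := Complex.abs_arg_lt_pi_div_two_iff.2 (Or.inl hm)
  simp only [logStrip, mem_ofPred_eq, Complex.mul_im, Complex.re_ofNat, Complex.im_ofNat,
    Complex.log_im, zero_mul, add_zero, abs_mul, abs_two]
  linarith

theorem norm_exp_half (ζ : ℂ) :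
    ‖Complex.exp (ζ / 2)‖ * Real.cos (ζ.im / 2) = (Complex.exp (ζ / 2)).re := by
  rw [Complex.norm_exp, Complex.exp_re]
  simp

/-- The **Schwarz–Pick inequality** for self-maps of the strip. -/
theorem norm_deriv_mul_cos_le {h : ℂ → ℂ} (hd : DifferentiableOn ℂ h logStrip)
    (hm : MapsTo h logStrip logStrip) {ζ : ℂ} (hζ : ζ ∈ logStrip) :
    ‖deriv h ζ‖ * Real.cos (ζ.im / 2) ≤ Real.cos ((h ζ).im / 2) := by
  -- The map exp(·/2) carries the strip onto the right half-plane. Below, φ sends the unit disc to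
  -- that half-plane with φ(0) = p, and χ sends the half-plane to the disc with χ(q) = 0, so the
  -- transported map k fixes 0 and Schwarz's lemma applies.
  set p := Complex.exp (ζ / 2) with hp
  set q := Complex.exp (h ζ / 2) with hq
  have hpr : 0 < p.re := exp_half_re_pos hζ
  have hqr : 0 < q.re := exp_half_re_pos (hm hζ)
  have hlogp : 2 * Complex.log p = ζ := by
    have := abs_lt.1 (show |ζ.im| < Real.pi from hζ)
    rw [hp, Complex.log_exp (by simp; linarith [Real.pi_pos]) (by simp; linarith [Real.pi_pos])]
    ring
  set φ : ℂ → ℂ := fun u => (p + (starRingEnd ℂ) p * u) / (1 - u) with hφ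
  set χ : ℂ → ℂ := fun w => (w - q) / (w + (starRingEnd ℂ) q) with hχ
  have hu1 : ∀ u ∈ Metric.ball (0 : ℂ) 1, 1 - u ≠ 0 := by
    intro u hu h0
    rw [sub_eq_zero] at h0
    rw [← h0] at hu
    simp at hu
  have hφre : ∀ u ∈ Metric.ball (0 : ℂ) 1, 0 < (φ u).re := by
    intro u hu
    have h1 := Complex.normSq_pos.2 (hu1 u hu)
    have e : (φ u).re = p.re * (1 - Complex.normSq u) / Complex.normSq (1 - u) := by
      simp only [hφ, Complex.div_re, Complex.add_re, Complex.mul_re, Complex.conj_re,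
        Complex.conj_im, Complex.sub_re, Complex.sub_im, Complex.one_re, Complex.one_im,
        Complex.add_im, Complex.mul_im]
      rw [← add_div]
      congr 1
      rw [Complex.normSq_apply]
      ring
    rw [e]
    have h2 : Complex.normSq u < 1 := by
      rw [Complex.normSq_eq_norm_sq]
      have : ‖u‖ < 1 := by simpa using hu
      nlinarith [norm_nonneg u]
    have : 0 < 1 - Complex.normSq u := by linarith
    positivity
  have hχden : ∀ w : ℂ, 0 < w.re → w + (starRingEnd ℂ) q ≠ 0 := by
    intro w hw h0
    have := congrArg Complex.re h0
    simp at this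
    linarith
  have hχmem : ∀ w : ℂ, 0 < w.re → ‖χ w‖ ≤ 1 := by
    intro w hw
    rw [hχ, norm_div, div_le_one (norm_pos_iff.2 (hχden w hw)), ← sq_le_sq₀ (norm_nonneg _)
      (norm_nonneg _), ← Complex.normSq_eq_norm_sq, ← Complex.normSq_eq_norm_sq,
      Complex.normSq_apply, Complex.normSq_apply]
    simp
    nlinarith [mul_pos hw hqr]
  set k : ℂ → ℂ := fun u => χ (Complex.exp (h (2 * Complex.log (φ u)) / 2)) with hk
  have hderiv : ∀ u ∈ Metric.ball (0 : ℂ) 1, ∀ v, v = 2 * Complex.log (φ u) →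
      ∀ w, w = Complex.exp (h v / 2) →
      HasDerivAt k ((1 * (w + (starRingEnd ℂ) q) - (w - q) * 1) / (w + (starRingEnd ℂ) q) ^ 2 *
        (w * (deriv h v * (2 * ((((starRingEnd ℂ) p * 1) * (1 - u) -
          (p + (starRingEnd ℂ) p * u) * (-1)) / (1 - u) ^ 2 / φ u)) / 2))) u := by
    rintro u hu v rfl w rfl
    have hv := two_mul_log_mem_logStrip (hφre u hu)
    have d1 : HasDerivAt φ ((((starRingEnd ℂ) p * 1) * (1 - u) -
          (p + (starRingEnd ℂ) p * u) * (-1)) / (1 - u) ^ 2) u :=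
      (((hasDerivAt_id u).const_mul _).const_add p).div ((hasDerivAt_id u).const_sub 1) (hu1 u hu)
    have d2 := (d1.clog (Or.inl (hφre u hu))).const_mul 2
    have d3 := (hd.differentiableAt (isOpen_logStrip.mem_nhds hv)).hasDerivAt.comp u d2
    have d4 := (d3.div_const 2).cexp
    have hw := exp_half_re_pos (hm hv)
    have d5 := ((hasDerivAt_id (Complex.exp (h (2 * Complex.log (φ u)) / 2))).sub_const q).div
      ((hasDerivAt_id _).add_const ((starRingEnd ℂ) q)) (hχden _ hw)
    exact d5.comp u d4
  have hk0 : k 0 = 0 := by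
    simp only [hk, hφ, mul_zero, add_zero, sub_zero, div_one, hlogp]
    simp [hχ, ← hq]
  have hbound : ‖deriv k 0‖ ≤ 1 := by
    refine Complex.norm_deriv_le_one_of_mapsTo_ball (R := 1) (fun u hu =>
      (hderiv u hu _ rfl _ rfl).differentiableAt.differentiableWithinAt) ?_ one_pos
    intro u hu
    rw [hk0, mem_closedBall_zero_iff]
    exact hχmem _ (exp_half_re_pos (hm (two_mul_log_mem_logStrip (hφre u hu))))
  have hφ0 : φ 0 = p := by simp [hφ]
  have h0 := hderiv 0 (Metric.mem_ball_self one_pos) ζ (by rw [hφ0, hlogp]) q rfl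
  have hpne : p ≠ 0 := Complex.exp_ne_zero _
  have hqq : q + (starRingEnd ℂ) q = ((2 * q.re : ℝ) : ℂ) := Complex.add_conj q
  have hpp : (starRingEnd ℂ) p + p = ((2 * p.re : ℝ) : ℂ) := by rw [add_comm, Complex.add_conj p]
  -- In modulus this is |h'(ζ)| (Re p / |p|) / (Re q / |q|), and the two ratios are the cosines in
  -- the claim.
  have hval : deriv k 0 = q * deriv h ζ * ((2 * p.re : ℝ) : ℂ) / (p * ((2 * q.re : ℝ) : ℂ)) := by
    have hne : ((2 * q.re : ℝ) : ℂ) ≠ 0 := by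
      exact_mod_cast (by positivity : (2 * q.re : ℝ) ≠ 0)
    rw [h0.deriv, hφ0, hqq, eq_sub_of_add_eq hpp]
    generalize ((2 * q.re : ℝ) : ℂ) = Q at hne
    generalize ((2 * p.re : ℝ) : ℂ) = P
    field_simp
    ring
  have hpn : 0 < ‖p‖ := norm_pos_iff.2 hpne
  have hqn : 0 < ‖q‖ := norm_pos_iff.2 (Complex.exp_ne_zero _)
  rw [hval, norm_div, norm_mul, norm_mul, norm_mul, Complex.norm_real, Complex.norm_real,
    Real.norm_of_nonneg (by positivity), Real.norm_of_nonneg (by positivity),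
    div_le_one (by positivity)] at hbound
  have ep := norm_exp_half ζ
  have eq := norm_exp_half (h ζ)
  rw [← hp] at ep
  rw [← hq] at eq
  rw [← ep, ← eq] at hbound
  have : (‖p‖ * ‖q‖) * (‖deriv h ζ‖ * Real.cos (ζ.im / 2))
      ≤ (‖p‖ * ‖q‖) * Real.cos ((h ζ).im / 2) := by linarith
  exact le_of_mul_le_mul_left this (by positivity)

/-! ### Fixed points of averaged self-maps of the strip -/

section
variable {h : ℂ → ℂ} {c : ℝ}

/-- The averaged map `ζ ↦ (1 - c) z + c h(ζ)`. -/
noncomputable def averagedMap (h : ℂ → ℂ) (c : ℝ) (z ζ : ℂ) : ℂ :=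
  ((1 - c : ℝ) : ℂ) * z + (c : ℂ) * h ζ

theorem averagedMap_im (z ζ : ℂ) :
    (averagedMap h c z ζ).im = (1 - c) * z.im + c * (h ζ).im := by
  rw [averagedMap, Complex.add_im, Complex.im_ofReal_mul, Complex.im_ofReal_mul]

/-- For R < π the bound is still below π: one application lands in a closed substrip independent of
ζ, which keeps the iterates away from the boundary. -/
theorem abs_averagedMap_im_le (hm : MapsTo h logStrip logStrip) (hc0 : 0 ≤ c) (hc1 : c < 1)
    {R : ℝ} {z ζ : ℂ} (hz : |z.im| ≤ R) (hζ : ζ ∈ logStrip) :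
    |(averagedMap h c z ζ).im| ≤ (1 - c) * R + c * Real.pi := by
  rw [averagedMap_im]
  refine (abs_add_le _ _).trans ?_
  rw [abs_mul, abs_mul, abs_of_nonneg hc0, abs_of_pos (sub_pos.2 hc1)]
  have : |(h ζ).im| ≤ Real.pi := le_of_lt (hm hζ)
  have := sub_pos.2 hc1
  gcongr

theorem averagedMap_mem (hm : MapsTo h logStrip logStrip) (hc0 : 0 ≤ c) (hc1 : c < 1)
    {z ζ : ℂ} (hz : z ∈ logStrip) (hζ : ζ ∈ logStrip) : averagedMap h c z ζ ∈ logStrip := by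
  refine lt_of_le_of_lt (abs_averagedMap_im_le hm hc0 hc1 le_rfl hζ) ?_
  have : |z.im| < Real.pi := hz
  nlinarith [sub_pos.2 hc1]

theorem iterate_averagedMap_mem (hm : MapsTo h logStrip logStrip) (hc0 : 0 ≤ c) (hc1 : c < 1)
    {z ζ : ℂ} (hz : z ∈ logStrip) (hζ : ζ ∈ logStrip) (n : ℕ) :
    (averagedMap h c z)^[n] ζ ∈ logStrip := by
  induction n with
  | zero => exact hζ
  | succ n ih =>
    rw [Function.iterate_succ_apply']
    exact averagedMap_mem hm hc0 hc1 hz ih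

theorem abs_iterate_averagedMap_im_le (hm : MapsTo h logStrip logStrip) (hc0 : 0 ≤ c)
    (hc1 : c < 1) {R : ℝ} (hR : R < Real.pi) {z : ℂ} (hz : |z.im| ≤ R) (n : ℕ) :
    |((averagedMap h c z)^[n] z).im| ≤ (1 - c) * R + c * Real.pi := by
  have hzS : z ∈ logStrip := lt_of_le_of_lt hz hR
  cases n with
  | zero => simp only [Function.iterate_zero, id]; nlinarith
  | succ n =>
    rw [Function.iterate_succ_apply']
    exact abs_averagedMap_im_le hm hc0 hc1 hz (iterate_averagedMap_mem hm hc0 hc1 hzS hzS n)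

theorem cos_half_le_of_abs_le {x R : ℝ} (hx : |x| ≤ R) (hR : R < Real.pi) :
    Real.cos (R / 2) ≤ Real.cos (x / 2) := by
  rw [← Real.cos_abs (x / 2), abs_div, abs_two]
  exact Real.cos_le_cos_of_nonneg_of_le_pi (by positivity) (by linarith [Real.pi_pos]) (by linarith)

/-- The source of strict contraction. Concavity gives cos(((1 - c) b + c a) / 2) ≥ (1 - c) C + c
cos(a / 2) ≥ ((1 - c) C + c) cos(a / 2), and c / (c + (1 - c) C) < 1 because C > 0. -/
theorem mul_cos_le_of_average (hc0 : 0 ≤ c) (hc1 : c < 1) {a b C : ℝ} (ha : |a| < Real.pi)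
    (hb : |b| < Real.pi) (hC0 : 0 < C) (hC : C ≤ Real.cos (b / 2)) :
    c * Real.cos (a / 2) ≤
      c / (c + (1 - c) * C) * Real.cos (((1 - c) * b + c * a) / 2) := by
  have hpos : 0 < c + (1 - c) * C := by
    have := mul_pos (sub_pos.2 hc1) hC0
    linarith
  rw [abs_lt] at ha hb
  have hcon := strictConcaveOn_cos_Icc.concaveOn.2
    (show b / 2 ∈ Icc (-(Real.pi / 2)) (Real.pi / 2) from ⟨by linarith, by linarith⟩)
    (show a / 2 ∈ Icc (-(Real.pi / 2)) (Real.pi / 2) from ⟨by linarith, by linarith⟩)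
    (sub_pos.2 hc1).le hc0 (by ring)
  simp only [smul_eq_mul] at hcon
  have e : (1 - c) * (b / 2) + c * (a / 2) = ((1 - c) * b + c * a) / 2 := by ring
  rw [e] at hcon
  rw [div_mul_eq_mul_div, le_div_iff₀ hpos, mul_assoc]
  refine mul_le_mul_of_nonneg_left (le_trans ?_ hcon) hc0
  have h1 : C * Real.cos (a / 2) ≤ C * 1 := by
    gcongr
    exact Real.cos_le_one _
  nlinarith [sub_pos.2 hc1]

/-- Chain rule in the metric |dζ| / cos(Im ζ / 2): each application contributes Schwarz–Pick for h
followed by the contraction factor of the averaging. -/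
theorem hasDerivAt_iterate_averagedMap (hd : DifferentiableOn ℂ h logStrip)
    (hm : MapsTo h logStrip logStrip) (hc0 : 0 ≤ c) (hc1 : c < 1) {z ζ : ℂ} (hz : z ∈ logStrip)
    (hζ : ζ ∈ logStrip) {C : ℝ} (hC0 : 0 < C) (hC : C ≤ Real.cos (z.im / 2)) (n : ℕ) :
    ∃ D, HasDerivAt ((averagedMap h c z)^[n]) D ζ ∧ ‖D‖ * Real.cos (ζ.im / 2) ≤
      (c / (c + (1 - c) * C)) ^ n * Real.cos (((averagedMap h c z)^[n] ζ).im / 2) := by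
  induction n with
  | zero => exact ⟨1, hasDerivAt_id ζ, by simp⟩
  | succ n ih =>
    obtain ⟨D, hD, hle⟩ := ih
    have hξ := iterate_averagedMap_mem hm hc0 hc1 hz hζ n
    set ξ := (averagedMap h c z)^[n] ζ with hξdef
    set k := c / (c + (1 - c) * C) with hk
    have hk0 : 0 ≤ k := by
      have := mul_pos (sub_pos.2 hc1) hC0
      positivity
    have d1 : HasDerivAt (averagedMap h c z) ((c : ℂ) * deriv h ξ) ξ :=
      ((hd.differentiableAt (isOpen_logStrip.mem_nhds hξ)).hasDerivAt.const_mul (c : ℂ)).const_add _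
    refine ⟨(c : ℂ) * deriv h ξ * D, ?_, ?_⟩
    · rw [Function.iterate_succ']
      exact d1.comp ζ hD
    · rw [Function.iterate_succ_apply', ← hξdef, averagedMap_im, norm_mul, norm_mul,
        Complex.norm_real, Real.norm_of_nonneg hc0]
      calc c * ‖deriv h ξ‖ * ‖D‖ * Real.cos (ζ.im / 2)
          = c * ‖deriv h ξ‖ * (‖D‖ * Real.cos (ζ.im / 2)) := by ring
        _ ≤ c * ‖deriv h ξ‖ * (k ^ n * Real.cos (ξ.im / 2)) := by gcongr
        _ = k ^ n * (c * (‖deriv h ξ‖ * Real.cos (ξ.im / 2))) := by ring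
        _ ≤ k ^ n * (c * Real.cos ((h ξ).im / 2)) := by
          gcongr
          exact norm_deriv_mul_cos_le hd hm hξ
        _ ≤ k ^ n * (k * Real.cos (((1 - c) * z.im + c * (h ξ).im) / 2)) := by
          refine mul_le_mul_of_nonneg_left ?_ (pow_nonneg hk0 n)
          exact mul_cos_le_of_average hc0 hc1 (hm hξ) hz hC0 hC
        _ = _ := by ring

/-- Consecutive iterates are the images under the n-th iterate of the first image of z and of z.
Both points lie in the convex substrip |Im| ≤ R', where the cosine is bounded below, so the
hyperbolic bound becomes a Euclidean mean value estimate. -/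
theorem norm_iterate_succ_sub_le (hd : DifferentiableOn ℂ h logStrip)
    (hm : MapsTo h logStrip logStrip) (hc0 : 0 ≤ c) (hc1 : c < 1) {R : ℝ} (hR0 : 0 ≤ R)
    (hR : R < Real.pi) {z : ℂ} (hz : |z.im| ≤ R) (n : ℕ) :
    ‖(averagedMap h c z)^[n + 1] z - (averagedMap h c z)^[n] z‖ ≤
      (c / (c + (1 - c) * Real.cos (R / 2))) ^ n / Real.cos (((1 - c) * R + c * Real.pi) / 2)
        * ‖averagedMap h c z z - z‖ := by
  set R' := (1 - c) * R + c * Real.pi with hR'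
  have hRR' : R ≤ R' := by nlinarith
  have hR'pi : R' < Real.pi := by nlinarith [sub_pos.2 hc1]
  have hcos : ∀ r, 0 ≤ r → r < Real.pi → 0 < Real.cos (r / 2) := fun r h1 h2 =>
    Real.cos_pos_of_mem_Ioo ⟨by linarith [Real.pi_pos], by linarith⟩
  have hC0 := hcos R hR0 hR
  have hC' := hcos R' (hR0.trans hRR') hR'pi
  have hzS : z ∈ logStrip := lt_of_le_of_lt hz hR
  set T : Set ℂ := Complex.im ⁻¹' Icc (-R') R' with hT
  have hTc : Convex ℝ T := (convex_Icc _ _).is_linear_preimage Complex.imLm.isLinear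
  have hmemT : ∀ {w : ℂ}, |w.im| ≤ R' → w ∈ T := fun hw => abs_le.1 hw
  have hTS : T ⊆ logStrip := fun w hw => lt_of_le_of_lt (abs_le.2 hw) hR'pi
  set k := c / (c + (1 - c) * Real.cos (R / 2)) with hk
  have hk0 : 0 ≤ k := by
    have := mul_pos (sub_pos.2 hc1) hC0
    positivity
  rw [Function.iterate_succ_apply]
  choose! D hD hle using fun w (hw : w ∈ T) => hasDerivAt_iterate_averagedMap hd hm hc0 hc1 hzS
    (hTS hw) hC0 (cos_half_le_of_abs_le hz hR) n
  refine hTc.norm_image_sub_le_of_norm_hasDerivWithin_le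
    (fun w hw => (hD w hw).hasDerivWithinAt) (fun w hw => ?_) (hmemT (hz.trans hRR'))
    (hmemT (abs_averagedMap_im_le hm hc0 hc1 hz hzS))
  rw [le_div_iff₀ hC']
  calc ‖D w‖ * Real.cos (R' / 2) ≤ ‖D w‖ * Real.cos (w.im / 2) := by
        gcongr
        exact cos_half_le_of_abs_le (abs_le.2 hw) hR'pi
    _ ≤ _ := hle w hw
    _ ≤ k ^ n * 1 := by
        gcongr
        exact Real.cos_le_one _
    _ = k ^ n := mul_one _

theorem differentiableOn_iterate_averagedMap (hd : DifferentiableOn ℂ h logStrip)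
    (hm : MapsTo h logStrip logStrip) (hc0 : 0 ≤ c) (hc1 : c < 1) (n : ℕ) :
    DifferentiableOn ℂ (fun z => (averagedMap h c z)^[n] z) logStrip := by
  induction n with
  | zero => exact differentiableOn_id
  | succ n ih =>
    simp only [Function.iterate_succ_apply']
    have := hd.comp ih fun z hz => iterate_averagedMap_mem hm hc0 hc1 hz hz n
    exact (differentiableOn_id.const_mul _).add (this.const_mul _)

/-- For a holomorphic self-map `h` of the strip and `0 ≤ c < 1`, the equation
`ζ = (1 - c) z + c h(ζ)` has a solution `ζ = W(z)` that is holomorphic in `z`, the limit of the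
iterates of `ζ ↦ (1 - c) z + c h(ζ)` starting at `z`. -/
theorem exists_fixedPoint_averagedMap (hd : DifferentiableOn ℂ h logStrip)
    (hm : MapsTo h logStrip logStrip) (hc0 : 0 ≤ c) (hc1 : c < 1) :
    ∃ W : ℂ → ℂ, DifferentiableOn ℂ W logStrip ∧ MapsTo W logStrip logStrip ∧
      (∀ z ∈ logStrip, averagedMap h c z (W z) = W z) ∧
      ∀ z ∈ logStrip, Tendsto (fun n => (averagedMap h c z)^[n] z) atTop (𝓝 (W z)) := by
  set d : ℕ → ℂ → ℂ := fun n z => (averagedMap h c z)^[n + 1] z - (averagedMap h c z)^[n] z with hdd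
  have hddiff : ∀ n, DifferentiableOn ℂ (d n) logStrip := fun n =>
    (differentiableOn_iterate_averagedMap hd hm hc0 hc1 (n + 1)).sub
      (differentiableOn_iterate_averagedMap hd hm hc0 hc1 n)
  have hloc : ∀ z₀ ∈ logStrip, ∃ U ⊆ logStrip, IsOpen U ∧ z₀ ∈ U ∧ ∃ u : ℕ → ℝ, Summable u ∧
      ∀ n, ∀ z ∈ U, ‖d n z‖ ≤ u n := by
    intro z₀ hz₀
    have hz₀' : |z₀.im| < Real.pi := hz₀
    set R := (|z₀.im| + Real.pi) / 2 with hR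
    have hR0 : 0 ≤ R := by positivity
    have hRpi : R < Real.pi := by linarith
    set B := ‖averagedMap h c z₀ z₀ - z₀‖ + 1 with hB
    have hcont : ContinuousOn (fun z => ‖averagedMap h c z z - z‖) logStrip :=
      (((differentiableOn_id.const_mul _).add (hd.const_mul _)).sub
        differentiableOn_id).continuousOn.norm
    refine ⟨{z | |z.im| < R} ∩ (logStrip ∩ (fun z => ‖averagedMap h c z z - z‖) ⁻¹' Iio B),
      fun z hz => hz.2.1, ?_, ⟨?_, hz₀, ?_⟩,
      fun n => (c / (c + (1 - c) * Real.cos (R / 2))) ^ n /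
        Real.cos (((1 - c) * R + c * Real.pi) / 2) * B, ?_, ?_⟩
    · exact (isOpen_lt (continuous_abs.comp Complex.continuous_im) continuous_const).inter
        (hcont.isOpen_inter_preimage isOpen_logStrip isOpen_Iio)
    · simp only [mem_ofPred_eq]; linarith
    · simp [hB]
    · have hC0 : 0 < Real.cos (R / 2) :=
        Real.cos_pos_of_mem_Ioo ⟨by linarith [Real.pi_pos], by linarith⟩
      have := mul_pos (sub_pos.2 hc1) hC0
      refine ((summable_geometric_of_lt_one (by positivity) ?_).div_const _).mul_right _
      rw [div_lt_one (by positivity)]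
      linarith
    · rintro n z ⟨hz1, -, hz2⟩
      refine (norm_iterate_succ_sub_le hd hm hc0 hc1 hR0 hRpi (le_of_lt hz1) n).trans ?_
      have hR' : (1 - c) * R + c * Real.pi < Real.pi := by nlinarith [sub_pos.2 hc1]
      have hR'0 : 0 ≤ (1 - c) * R + c * Real.pi := by
        have := sub_pos.2 hc1
        positivity
      have hC0 : 0 < Real.cos (R / 2) :=
        Real.cos_pos_of_mem_Ioo ⟨by linarith [Real.pi_pos], by linarith⟩
      have hC' : 0 < Real.cos (((1 - c) * R + c * Real.pi) / 2) :=
        Real.cos_pos_of_mem_Ioo ⟨by linarith [Real.pi_pos], by linarith⟩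
      have := mul_pos (sub_pos.2 hc1) hC0
      have hz2' : ‖averagedMap h c z z - z‖ ≤ B := le_of_lt hz2
      exact mul_le_mul_of_nonneg_left hz2' (by positivity)
  -- The limit written as a telescoping series, so that locally uniform summability yields
  -- holomorphy.
  set W : ℂ → ℂ := fun z => z + ∑' n, d n z with hW
  have htend : ∀ z ∈ logStrip, Tendsto (fun n => (averagedMap h c z)^[n] z) atTop (𝓝 (W z)) := by
    intro z hz
    obtain ⟨U, -, -, hzU, u, hu, hb⟩ := hloc z hz
    have hs : Summable fun n => d n z := Summable.of_norm_bounded hu fun n => hb n z hzU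
    have h1 := hs.hasSum.tendsto_sum_nat.const_add z
    refine h1.congr fun n => ?_
    simp only [hdd]
    rw [Finset.sum_range_sub (fun n => (averagedMap h c z)^[n] z)]
    simp
  have hmaps : MapsTo W logStrip logStrip := by
    intro z hz
    have hz' : |z.im| < Real.pi := hz
    have h1 : |(W z).im| ≤ (1 - c) * |z.im| + c * Real.pi :=
      le_of_tendsto ((Complex.continuous_im.abs.tendsto _).comp (htend z hz))
        (Eventually.of_forall fun n => abs_iterate_averagedMap_im_le hm hc0 hc1 hz' le_rfl n)
    refine lt_of_le_of_lt h1 ?_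
    nlinarith [sub_pos.2 hc1]
  refine ⟨W, fun z hz => ?_, hmaps, fun z hz => ?_, htend⟩
  · obtain ⟨U, hUS, hU, hzU, u, hu, hb⟩ := hloc z hz
    have := Complex.differentiableOn_tsum_of_summable_norm hu (fun n => (hddiff n).mono hUS) hU hb
    exact ((differentiableAt_id.add
      (this.differentiableAt (hU.mem_nhds hzU)))).differentiableWithinAt
  · have h1 := (tendsto_add_atTop_iff_nat 1).2 (htend z hz)
    simp only [Function.iterate_succ_apply'] at h1
    have h2 : ContinuousAt (averagedMap h c z) (W z) :=
      continuousAt_const.add (continuousAt_const.mul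
        (hd.continuousOn.continuousAt (isOpen_logStrip.mem_nhds (hmaps hz))))
    exact tendsto_nhds_unique (h2.tendsto.comp (htend z hz)) h1

end

/-! ### Herglotz representation on the diameter of the disc -/

/-- The Poisson kernel of the unit disc at a real point `u` and the boundary point with real part
`1 - 2 r`. -/
noncomputable def realPoissonKernel (u r : ℝ) : ℝ :=
  (1 - u ^ 2) / (1 - 2 * u * (1 - 2 * r) + u ^ 2)

theorem realPoissonKernel_denom_pos {u r : ℝ} (hu : |u| < 1) (hr : r ∈ Icc (0 : ℝ) 1) :
    0 < 1 - 2 * u * (1 - 2 * r) + u ^ 2 := by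
  rw [abs_lt] at hu
  have h1 : 0 < (1 - u) ^ 2 := pow_pos (by linarith [hu.2]) 2
  have h2 : 0 < (1 + u) ^ 2 := pow_pos (by linarith [hu.1]) 2
  have e : 1 - 2 * u * (1 - 2 * r) + u ^ 2 = (1 - r) * (1 - u) ^ 2 + r * (1 + u) ^ 2 := by ring
  rw [e]
  rcases hr.1.eq_or_lt with h | h
  · rw [← h]; simpa using h1
  · have := mul_nonneg (sub_nonneg.2 hr.2) h1.le
    have := mul_pos h h2
    linarith

theorem continuous_realPoissonKernel {u : ℝ} (hu : |u| < 1) :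
    Continuous fun r : unitInterval => realPoissonKernel u r := by
  unfold realPoissonKernel
  exact Continuous.div (by fun_prop) (by fun_prop)
    fun r => (realPoissonKernel_denom_pos hu r.2).ne'

theorem half_one_sub_cos_mem (θ : ℝ) : (1 - Real.cos θ) / 2 ∈ Icc (0 : ℝ) 1 :=
  ⟨by linarith [Real.cos_le_one θ], by linarith [Real.neg_one_le_cos θ]⟩

/-- Poisson's formula for w ↦ F(ρw), which is holomorphic across the unit circle, with boundary
density Re F / 2π. At a real point the kernel depends on the angle θ only through cos θ, so the
measure may be pushed forward by r = (1 - cos θ) / 2. -/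
theorem exists_measure_realPoissonKernel_of_radius {F : ℂ → ℂ}
    (hF : DifferentiableOn ℂ F (Metric.ball 0 1)) (hpos : ∀ u ∈ Metric.ball 0 1, 0 ≤ (F u).re)
    {ρ : ℝ} (hρ0 : 0 < ρ) (hρ1 : ρ < 1) :
    ∃ σ : FiniteMeasure unitInterval, ∀ u : ℝ, |u| < 1 →
      ∫ r, realPoissonKernel u r ∂(σ : Measure unitInterval) = (F (ρ * u)).re := by
  have hmem : ∀ w : ℂ, ‖w‖ ≤ 1 → (ρ : ℂ) * w ∈ Metric.ball (0 : ℂ) 1 := by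
    intro w hw
    rw [mem_ball_zero_iff, norm_mul, Complex.norm_real, Real.norm_of_nonneg hρ0.le]
    nlinarith [norm_nonneg w]
  have hdcl : DiffContOnCl ℂ (fun w => F (ρ * w)) (Metric.ball 0 1) := by
    refine DifferentiableOn.diffContOnCl ?_
    rw [closure_ball _ one_ne_zero]
    exact hF.comp (by fun_prop) fun w hw => hmem w (by simpa using hw)
  set D : ℝ → ℝ := fun θ => (2 * Real.pi)⁻¹ * (F (ρ * circleMap 0 1 θ)).re with hD
  have hDc : Continuous D := by
    refine continuous_const.mul (Complex.continuous_re.comp ?_)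
    refine hF.continuousOn.comp_continuous (continuous_const.mul (continuous_circleMap 0 1))
      fun θ => hmem _ (by simp [circleMap])
  have hD0 : ∀ θ, 0 ≤ D θ := fun θ =>
    mul_nonneg (by positivity) (hpos _ (hmem _ (by simp [circleMap])))
  set τ : Measure ℝ := (volume.restrict (Ioc 0 (2 * Real.pi))).withDensity
    fun θ => ENNReal.ofReal (D θ) with hτ
  have hτfin : IsFiniteMeasure τ := by
    refine isFiniteMeasure_withDensity_ofReal ?_
    exact (hDc.integrableOn_Ioc).2
  set P : ℝ → unitInterval := fun θ => ⟨(1 - Real.cos θ) / 2, half_one_sub_cos_mem θ⟩ with hP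
  have hPc : Continuous P := by
    exact Continuous.subtype_mk (by fun_prop) _
  refine ⟨⟨τ.map P, inferInstance⟩, fun u hu => ?_⟩
  have hum : (u : ℂ) ∈ Metric.ball (0 : ℂ) 1 := by simpa using hu
  have hpois := hdcl.circleAverage_poissonKernel_smul' hum
  have hker : ∀ θ : ℝ, ((‖circleMap 0 1 θ - 0‖ ^ 2 - ‖(u : ℂ) - 0‖ ^ 2) /
      ‖(circleMap 0 1 θ - 0) - ((u : ℂ) - 0)‖ ^ 2) = realPoissonKernel u (P θ) := by
    intro θ
    have e : ‖circleMap 0 1 θ - (u : ℂ)‖ ^ 2 = 1 - 2 * u * (1 - 2 * ((1 - Real.cos θ) / 2))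
        + u ^ 2 := by
      rw [← Complex.normSq_eq_norm_sq, Complex.normSq_apply, circleMap_zero]
      simp [Complex.exp_ofReal_mul_I_re, Complex.exp_ofReal_mul_I_im]
      nlinarith [Real.sin_sq_add_cos_sq θ]
    simp only [sub_zero, realPoissonKernel, hP, e]
    simp [circleMap_zero]
  simp only [Real.circleAverage_def, hker] at hpois
  rw [FiniteMeasure.toMeasure_mk, integral_map hPc.aemeasurable
    (continuous_realPoissonKernel hu).aestronglyMeasurable, hτ,
    integral_withDensity_eq_integral_toReal_smul (by fun_prop)
    (ae_of_all _ fun _ => ENNReal.ofReal_lt_top)]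
  have hcont : Continuous fun θ : ℝ => realPoissonKernel u (P θ) • F (ρ * circleMap 0 1 θ) := by
    refine ((continuous_realPoissonKernel hu).comp hPc).smul ?_
    exact hF.continuousOn.comp_continuous (continuous_const.mul (continuous_circleMap 0 1))
      fun θ => hmem _ (by simp [circleMap])
  have hre := congrArg Complex.re hpois
  rw [intervalIntegral.integral_of_le (by positivity), Complex.smul_re] at hre
  have hi := integral_re (μ := volume.restrict (Ioc 0 (2 * Real.pi)))
    (hcont.integrableOn_Ioc)
  simp only [RCLike.re_eq_complex_re] at hi
  rw [← hi, smul_eq_mul, ← integral_const_mul] at hre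
  rw [← hre]
  refine integral_congr_ae (ae_of_all _ fun θ => ?_)
  change (ENNReal.ofReal (D θ)).toReal • realPoissonKernel u (P θ) = _
  rw [ENNReal.toReal_ofReal (hD0 θ)]
  simp only [hD, smul_eq_mul, Complex.smul_re]
  ring

/-- **Herglotz representation** on the real diameter of the unit disc. -/
theorem exists_measure_realPoissonKernel {F : ℂ → ℂ}
    (hF : DifferentiableOn ℂ F (Metric.ball 0 1)) (hpos : ∀ u ∈ Metric.ball 0 1, 0 ≤ (F u).re) :
    ∃ σ : FiniteMeasure unitInterval, ∀ u : ℝ, |u| < 1 →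
      ∫ r, realPoissonKernel u r ∂(σ : Measure unitInterval) = (F u).re := by
  have hρ : Tendsto (fun n : ℕ => 1 - 1 / ((n : ℝ) + 2)) atTop (𝓝 1) := by
    have : Tendsto (fun n : ℕ => 1 / ((n : ℝ) + 2)) atTop (𝓝 0) :=
      tendsto_const_nhds.div_atTop (tendsto_natCast_atTop_atTop.atTop_add tendsto_const_nhds)
    simpa using this.const_sub 1
  choose σ hσ using fun n : ℕ => exists_measure_realPoissonKernel_of_radius hF hpos
    (ρ := 1 - 1 / ((n : ℝ) + 2))
    (by rw [sub_pos, div_lt_one (by positivity)]; linarith [n.cast_nonneg (α := ℝ)])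
    (by have : 0 < 1 / ((n : ℝ) + 2) := by positivity
        linarith)
  -- At u = 0 the kernel is 1, so all the measures have mass Re F(0). They lie in a weakly compact
  -- set, and a limit along an ultrafilter represents F as ρ → 1.
  have hmass : ∀ n, (σ n).mass = (F 0).re.toNNReal := by
    intro n
    have h := hσ n 0 (by simp)
    have hk : ∀ r : unitInterval, realPoissonKernel 0 r = 1 := by simp [realPoissonKernel]
    simp only [hk, Complex.ofReal_zero, mul_zero, integral_const, smul_eq_mul, mul_one] at h
    rw [← h]
    exact (Real.toNNReal_coe (r := (σ n).mass)).symm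
  obtain ⟨s, -, hs⟩ := (isCompact_setOfPred_finiteMeasure_eq_of_compactSpace unitInterval
    (F 0).re.toNNReal).ultrafilter_le_nhds ((hyperfilter ℕ).map σ)
    (by
      rw [Ultrafilter.coe_map, le_principal_iff, mem_map]
      exact univ_mem' hmass)
  have hs' : Tendsto σ (hyperfilter ℕ : Filter ℕ) (𝓝 s) := hs
  refine ⟨s, fun u hu => ?_⟩
  have h1 := FiniteMeasure.tendsto_iff_forall_integral_tendsto.1 hs'
    (BoundedContinuousFunction.mkOfCompact ⟨_, continuous_realPoissonKernel hu⟩)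
  simp only [BoundedContinuousFunction.mkOfCompact_apply, ContinuousMap.coe_mk, hσ _ u hu] at h1
  have hum : (u : ℂ) ∈ Metric.ball (0 : ℂ) 1 := by simpa using hu
  have h2 : Tendsto (fun n : ℕ => (F (((1 - 1 / ((n : ℝ) + 2) : ℝ) : ℂ) * u)).re) atTop
      (𝓝 (F u).re) := by
    have hc : ContinuousAt F ((1 : ℝ) * u) := by
      simpa using hF.continuousOn.continuousAt (Metric.isOpen_ball.mem_nhds hum)
    have h3 : Tendsto (fun n : ℕ => ((1 - 1 / ((n : ℝ) + 2) : ℝ) : ℂ) * u) atTop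
        (𝓝 ((1 : ℝ) * u)) :=
      ((Complex.continuous_ofReal.tendsto 1).comp hρ).mul_const _
    have h4 := (Complex.continuous_re.tendsto _).comp (hc.tendsto.comp h3)
    simpa using! h4
  exact tendsto_nhds_unique h1 (h2.mono_left Nat.hyperfilter_le_atTop)

/-! ### Stieltjes representation on the slit plane -/

theorem neg_sq_mem_slitDomain {m : ℂ} (hm : 0 < m.re) : -m ^ 2 ∈ slitDomain := by
  rintro ⟨h1, h2⟩
  simp only [sq, Complex.neg_re, Complex.neg_im, Complex.mul_re, Complex.mul_im] at h1 h2
  have h3 : m.re * m.im = 0 := by linarith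
  have h4 : m.im = 0 := (mul_eq_zero.1 h3).resolve_left hm.ne'
  rw [h4] at h1
  nlinarith

theorem cayley_re_pos {u : ℂ} (hu : u ∈ Metric.ball (0 : ℂ) 1) : 0 < ((1 + u) / (1 - u)).re := by
  have hn : ‖u‖ < 1 := by simpa using hu
  have h1 : 1 - u ≠ 0 := by
    intro h0
    rw [← sub_eq_zero.1 h0] at hn
    simp at hn
  have hN := Complex.normSq_pos.2 h1
  have h2 : Complex.normSq u < 1 := by
    rw [Complex.normSq_eq_norm_sq]
    nlinarith [norm_nonneg u]
  have e : ((1 + u) / (1 - u)).re = (1 - Complex.normSq u) / Complex.normSq (1 - u) := by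
    rw [Complex.div_re, ← add_div]
    congr 1
    rw [Complex.normSq_apply]
    simp
    ring
  rw [e]
  exact div_pos (by linarith) hN

section
variable {f : ℂ → ℂ}

/-- The compactified Stieltjes representation, with the variable `r = s / (1 + s)`. -/
theorem exists_measure_unitInterval (hf : DifferentiableOn ℂ f slitDomain)
    (hpos : ∀ m : ℂ, 0 < m.re → 0 ≤ (m * f (-m ^ 2)).re) :
    ∃ σ : Measure unitInterval, IsFiniteMeasure σ ∧ ∀ x : ℝ, x < 0 →
      ∫ r : unitInterval, ((1 - (r : ℝ)) - r * x)⁻¹ ∂σ = (f x).re := by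
  have hne : ∀ u ∈ Metric.ball (0 : ℂ) 1, 1 - u ≠ 0 := by
    intro u hu h0
    rw [← sub_eq_zero.1 h0] at hu
    simp at hu
  have hcd : DifferentiableOn ℂ (fun u : ℂ => (1 + u) / (1 - u)) (Metric.ball 0 1) :=
    DifferentiableOn.div (by fun_prop) (by fun_prop) hne
  obtain ⟨σ, hσ⟩ := exists_measure_realPoissonKernel
    (F := fun u => (1 + u) / (1 - u) * f (-((1 + u) / (1 - u)) ^ 2))
    (hcd.mul (hf.comp (hcd.pow 2).neg fun u hu => neg_sq_mem_slitDomain (cayley_re_pos hu)))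
    fun u hu => hpos _ (cayley_re_pos hu)
  refine ⟨σ, inferInstance, fun x hx => ?_⟩
  -- The Cayley map m = (1 + u) / (1 - u) sends u = (y - 1) / (y + 1) to y, where -y² = x; the
  -- Poisson kernel at this u is y / ((1 - r) - r x), and the factor y cancels.
  set y := √(-x) with hy
  have hy0 : 0 < y := Real.sqrt_pos.2 (by linarith)
  have hyx : y ^ 2 = -x := Real.sq_sqrt (by linarith)
  have hu : |(y - 1) / (y + 1)| < 1 := by
    rw [abs_lt, lt_div_iff₀ (by positivity), div_lt_one (by positivity)]
    constructor <;> linarith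
  have h := hσ _ hu
  have hm : (1 + (((y - 1) / (y + 1) : ℝ) : ℂ)) / (1 - (((y - 1) / (y + 1) : ℝ) : ℂ)) = (y : ℂ) := by
    have : (1 + ((y - 1) / (y + 1))) / (1 - ((y - 1) / (y + 1))) = y := by
      field_simp
      ring
    exact_mod_cast congrArg (fun t : ℝ => (t : ℂ)) this
  have hx2 : -(y : ℂ) ^ 2 = x := by
    exact_mod_cast (by linarith : -y ^ 2 = x)
  simp only [hm, hx2] at h
  rw [Complex.re_ofReal_mul] at h
  have hk : ∀ r : unitInterval, realPoissonKernel ((y - 1) / (y + 1)) r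
      = y * ((1 - (r : ℝ)) - r * x)⁻¹ := by
    intro r
    have hxy : x = -y ^ 2 := by linarith
    have h1 : 0 < (1 - (r : ℝ)) - r * x := by
      rcases r.2.1.eq_or_lt with h0 | h0
      · rw [← h0]; norm_num
      · nlinarith [r.2.2, mul_pos h0 (neg_pos.2 hx)]
    have hden := realPoissonKernel_denom_pos hu r.2
    rw [realPoissonKernel, ← div_eq_mul_inv, div_eq_div_iff hden.ne' h1.ne']
    rw [hxy]
    field_simp
    ring
  simp only [hk] at h
  rw [integral_const_mul] at h
  exact mul_left_cancel₀ hy0.ne' h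

/-- A **Stieltjes representation** theorem: a function `f` on the slit plane for which
`m f(-m²)` has nonnegative real part on the right half-plane and `f(0-) = 1` is, on `(-∞, 0)`, the
transform `∫ 1 / (1 - x s) dμ(s)` of a probability measure on `[0, ∞)`. -/
theorem exists_probabilityMeasure_geomTransform (hf : DifferentiableOn ℂ f slitDomain)
    (hpos : ∀ m : ℂ, 0 < m.re → 0 ≤ (m * f (-m ^ 2)).re)
    (hreal : ∀ x : ℝ, x < 0 → (f x).im = 0)
    (hlim : Tendsto (fun x : ℝ => f x) (𝓝[<] 0) (𝓝 1)) :
    ∃ μ : Measure ℝ≥0, IsProbabilityMeasure μ ∧ ∀ x : ℝ, x < 0 → geomTransform μ x = f x := by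
  obtain ⟨σ, hfin, hσ⟩ := exists_measure_unitInterval hf hpos
  have hden : ∀ {x : ℝ}, x < 0 → ∀ r : unitInterval, 0 < (1 - (r : ℝ)) - r * x := by
    intro x hx r
    rcases r.2.1.eq_or_lt with h0 | h0
    · rw [← h0]; norm_num
    · nlinarith [r.2.2, mul_pos h0 (neg_pos.2 hx)]
  have hcont : ∀ {x : ℝ}, x < 0 → Continuous fun r : unitInterval => ((1 - (r : ℝ)) - r * x)⁻¹ :=
    fun hx => Continuous.inv₀ (by fun_prop) fun r => (hden hx r).ne'
  have hint : ∀ {x : ℝ}, x < 0 →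
      Integrable (fun r : unitInterval => ((1 - (r : ℝ)) - r * x)⁻¹) σ := fun hx =>
    (BoundedContinuousFunction.mkOfCompact ⟨_, hcont hx⟩).integrable σ
  set G : unitInterval → ENNReal := fun r => (ENNReal.ofReal (1 - r))⁻¹ with hG
  have hGm : Measurable G := by fun_prop
  set x : ℕ → ℝ := fun n => -(1 / ((n : ℝ) + 1)) with hx
  have hx0 : ∀ n, x n < 0 := fun n => by
    have : 0 < 1 / ((n : ℝ) + 1) := by positivity
    simp only [hx]; linarith
  have hxt : Tendsto x atTop (𝓝 0) := by
    simpa [hx] using (tendsto_one_div_add_atTop_nhds_zero_nat (𝕜 := ℝ)).neg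
  have hxt' : Tendsto x atTop (𝓝[<] 0) :=
    tendsto_nhdsWithin_iff.2 ⟨hxt, Eventually.of_forall hx0⟩
  -- Monotone convergence along xₙ ↑ 0 gives ∫ 1 / (1 - r) dσ = f(0-) = 1. As G is ⊤ at r = 1, σ has
  -- no mass there; thus G dσ is a probability measure, and r ↦ r / (1 - r) carries it to [0, ∞).
  have hGint : ∫⁻ r, G r ∂σ = 1 := by
    have h1 : Tendsto (fun n => ∫⁻ r : unitInterval,
        (ENNReal.ofReal ((1 - (r : ℝ)) - r * x n))⁻¹ ∂σ) atTop (𝓝 (∫⁻ r, G r ∂σ)) := by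
      refine lintegral_tendsto_of_tendsto_of_monotone (fun n => by fun_prop)
        (ae_of_all _ fun r => ?_) (ae_of_all _ fun r => ?_)
      · intro n k hnk
        refine ENNReal.inv_le_inv.2 (ENNReal.ofReal_le_ofReal ?_)
        have : x n ≤ x k := by
          simp only [hx]
          have := one_div_le_one_div_of_le (by positivity : (0 : ℝ) < n + 1)
            (by exact_mod_cast Nat.succ_le_succ hnk : (n : ℝ) + 1 ≤ k + 1)
          linarith
        nlinarith [r.2.1, mul_le_mul_of_nonneg_left this r.2.1]
      · refine tendsto_inv_iff.2 (ENNReal.tendsto_ofReal ?_)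
        simpa using (hxt.const_mul (r : ℝ)).const_sub (1 - (r : ℝ))
    have h2 : ∀ n, ∫⁻ r : unitInterval, (ENNReal.ofReal ((1 - (r : ℝ)) - r * x n))⁻¹ ∂σ
        = ENNReal.ofReal (f (x n)).re := by
      intro n
      rw [← hσ _ (hx0 n), ofReal_integral_eq_lintegral_ofReal (hint (hx0 n))
        (ae_of_all _ fun r => (inv_pos.2 (hden (hx0 n) r)).le)]
      refine lintegral_congr fun r => ?_
      rw [ENNReal.ofReal_inv_of_pos (hden (hx0 n) r)]
    simp only [h2] at h1
    have h3 : Tendsto (fun n => ENNReal.ofReal (f (x n)).re) atTop (𝓝 1) := by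
      have := ENNReal.tendsto_ofReal ((Complex.continuous_re.tendsto _).comp (hlim.comp hxt'))
      simpa using! this
    exact tendsto_nhds_unique h1 h3
  have hGtop : ∀ᵐ r ∂σ, G r < ⊤ := ae_lt_top hGm (by rw [hGint]; exact ENNReal.one_ne_top)
  have hlt : ∀ᵐ r : unitInterval ∂σ, (r : ℝ) < 1 := by
    filter_upwards [hGtop] with r hr
    simp only [hG, ENNReal.inv_lt_top, ENNReal.ofReal_pos] at hr
    linarith
  set S : unitInterval → ℝ≥0 := fun r => ((r : ℝ) / (1 - r)).toNNReal with hS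
  have hSm : Measurable S := by
    refine measurable_real_toNNReal.comp (Measurable.div ?_ ?_) <;> fun_prop
  have hprob : IsProbabilityMeasure (σ.withDensity G) :=
    ⟨by rw [withDensity_apply _ MeasurableSet.univ, Measure.restrict_univ, hGint]⟩
  refine ⟨(σ.withDensity G).map S, Measure.isProbabilityMeasure_map hSm.aemeasurable,
    fun x hx => ?_⟩
  rw [geomTransform, integral_map hSm.aemeasurable
    (by fun_prop : Measurable fun s : ℝ≥0 => (1 - (x : ℂ) * ((s : ℝ) : ℂ))⁻¹).aestronglyMeasurable,
    integral_withDensity_eq_integral_toReal_smul hGm hGtop]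
  have hfx : f x = (((f x).re : ℝ) : ℂ) := Complex.ext rfl (by simpa using hreal x hx)
  rw [hfx, ← hσ x hx, ← integral_complex_ofReal]
  refine integral_congr_ae ?_
  filter_upwards [hlt] with r hr
  have h1 : 0 < 1 - (r : ℝ) := by linarith
  have h2 := (hden hx r).ne'
  have h3 : ((S r : ℝ≥0) : ℝ) = r / (1 - r) := by
    simp only [hS]
    exact Real.coe_toNNReal _ (div_nonneg r.2.1 h1.le)
  have h4 : (G r).toReal = (1 - (r : ℝ))⁻¹ := by
    simp only [hG]
    rw [ENNReal.toReal_inv, ENNReal.toReal_ofReal h1.le]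
  rw [h3, h4, Complex.real_smul]
  have h5 : (1 - (r : ℝ))⁻¹ * (1 - x * (r / (1 - r)))⁻¹ = ((1 - (r : ℝ)) - r * x)⁻¹ := by
    rw [← mul_inv]
    congr 1
    field_simp
  rw [← h5]
  push_cast
  rfl

end

/-! ### The logarithmic coordinate z = -exp ζ -/

theorem log_neg_mem_logStrip {z : ℂ} (hz : z ∈ slitDomain) : Complex.log (-z) ∈ logStrip := by
  have h := mem_slitDomain_iff.1 hz
  have h1 : (-z).arg ≠ Real.pi := (Complex.mem_slitPlane_iff_arg.1 h).1
  simp only [logStrip, mem_ofPred_eq, Complex.log_im]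
  rw [abs_lt]
  exact ⟨Complex.neg_pi_lt_arg _, lt_of_le_of_ne (Complex.arg_le_pi _) h1⟩

theorem log_exp_of_mem_logStrip {ζ : ℂ} (hζ : ζ ∈ logStrip) : Complex.log (Complex.exp ζ) = ζ := by
  have h := abs_lt.1 (show |ζ.im| < Real.pi from hζ)
  exact Complex.log_exp h.1 h.2.le

theorem neg_exp_mem_slitDomain {ζ : ℂ} (hζ : ζ ∈ logStrip) : -Complex.exp ζ ∈ slitDomain := by
  rw [mem_slitDomain_iff, neg_neg, Complex.mem_slitPlane_iff_arg, ← Complex.log_im,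
    log_exp_of_mem_logStrip hζ]
  exact ⟨(abs_lt.1 (show |ζ.im| < Real.pi from hζ)).2.ne, Complex.exp_ne_zero _⟩

theorem neg_exp_log_neg {z : ℂ} (hz : z ∈ slitDomain) : -Complex.exp (Complex.log (-z)) = z := by
  rw [Complex.exp_log (neg_ne_zero.2 (ne_zero_of_mem_slitDomain hz)), neg_neg]

theorem log_neg_neg_exp {ζ : ℂ} (hζ : ζ ∈ logStrip) : Complex.log (-(-Complex.exp ζ)) = ζ := by
  rw [neg_neg, log_exp_of_mem_logStrip hζ]

theorem log_neg_ofReal {x : ℝ} (hx : x < 0) : Complex.log (-(x : ℂ)) = (Real.log (-x) : ℝ) := by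
  rw [Complex.ofReal_log (by linarith)]
  push_cast
  rfl

theorem DifferentiableOn.log_neg {g : ℂ → ℂ} {s : Set ℂ} (hg : DifferentiableOn ℂ g s)
    (hm : MapsTo g s slitDomain) : DifferentiableOn ℂ (fun z => Complex.log (-g z)) s :=
  hg.neg.clog fun _ hz => mem_slitDomain_iff.1 (hm hz)

theorem isPreconnected_slitDomain : IsPreconnected slitDomain := by
  have hconv : Convex ℝ logStrip := by
    have : logStrip = Complex.im ⁻¹' Ioo (-Real.pi) Real.pi := by
      ext ζ; simp [logStrip, abs_lt]
    rw [this]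
    exact (convex_Ioo _ _).is_linear_preimage Complex.imLm.isLinear
  have : slitDomain = (fun ζ => -Complex.exp ζ) '' logStrip := by
    ext z
    exact ⟨fun hz => ⟨_, log_neg_mem_logStrip hz, neg_exp_log_neg hz⟩,
      by rintro ⟨ζ, hζ, rfl⟩; exact neg_exp_mem_slitDomain hζ⟩
  rw [this]
  exact hconv.isPreconnected.image _ (by fun_prop)

/-- A principle of isolated zeros on the slit plane. -/
theorem eqOn_slitDomain_of_eq_neg {f g : ℂ → ℂ} (hf : DifferentiableOn ℂ f slitDomain)
    (hg : DifferentiableOn ℂ g slitDomain) (h : ∀ x : ℝ, x < 0 → f x = g x) :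
    EqOn f g slitDomain := by
  refine (hf.analyticOnNhd isOpen_slitDomain).eqOn_of_preconnected_of_frequently_eq
    (hg.analyticOnNhd isOpen_slitDomain) isPreconnected_slitDomain
    (ofReal_mem_slitDomain (x := -1) (by norm_num)) ?_
  have ht : Tendsto (fun x : ℝ => (x : ℂ)) (𝓝[≠] (-1)) (𝓝[≠] ((-1 : ℝ) : ℂ)) := by
    refine tendsto_nhdsWithin_of_tendsto_nhds_of_eventually_within _
      ((Complex.continuous_ofReal.tendsto _).mono_left nhdsWithin_le_nhds) ?_
    filter_upwards [self_mem_nhdsWithin] with x hx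
    simpa using fun h0 => hx (Complex.ofReal_injective h0)
  refine ht.frequently (Eventually.frequently ?_)
  filter_upwards [nhdsWithin_le_nhds (Iio_mem_nhds (show (-1 : ℝ) < 0 by norm_num))] with x hx
  exact h x hx

/-- The two signs cancel in (-z) / (-g(z)), so log(-z) - log(-g(z)) is the required logarithm, real
on (-∞, 0). -/
theorem isPositivePower_div {g : ℂ → ℂ} (hg : DifferentiableOn ℂ g slitDomain)
    (hm : MapsTo g slitDomain slitDomain)
    (hreal : ∀ x : ℝ, x < 0 → ∃ y : ℝ, y < 0 ∧ g x = y) (s : ℝ) :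
    IsPositivePower (fun z => z / g z) s
      fun z => Complex.exp (s * (Complex.log (-z) - Complex.log (-g z))) := by
  refine ⟨fun z => Complex.log (-z) - Complex.log (-g z),
    DifferentiableOn.analyticOnNhd ?_ isOpen_slitDomain, fun z hz => ?_, fun x hx => ?_,
    fun z _ => rfl⟩
  · exact (differentiableOn_id.log_neg fun _ hz => hz).sub (hg.log_neg hm)
  · rw [Complex.exp_sub, Complex.exp_log (neg_ne_zero.2 (ne_zero_of_mem_slitDomain hz)),
      Complex.exp_log (neg_ne_zero.2 (ne_zero_of_mem_slitDomain (hm hz))), neg_div_neg_eq]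
  · obtain ⟨y, hy, h⟩ := hreal x hx
    simp only
    rw [h, log_neg_ofReal hx, log_neg_ofReal hy, ← Complex.ofReal_sub, Complex.ofReal_im]

/-! ### η_μ and the subordination equation in the strip -/

section
variable {μ : Measure ℝ≥0} [IsProbabilityMeasure μ]

/-- The function `η_μ` in the logarithmic coordinate `ζ`, `z = -exp ζ`. -/
noncomputable def logEta (μ : Measure ℝ≥0) (ζ : ℂ) : ℂ :=
  Complex.log (-etaTransform μ (-Complex.exp ζ))

theorem differentiableOn_logEta (hμ : μ ≠ Measure.dirac 0) :
    DifferentiableOn ℂ (logEta μ) logStrip :=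
  DifferentiableOn.log_neg ((differentiableOn_etaTransform hμ).comp (by fun_prop)
    fun _ hζ => neg_exp_mem_slitDomain hζ)
    fun _ hζ => etaTransform_mem_slitDomain hμ (neg_exp_mem_slitDomain hζ)

theorem mapsTo_logEta (hμ : μ ≠ Measure.dirac 0) : MapsTo (logEta μ) logStrip logStrip :=
  fun _ hζ => log_neg_mem_logStrip (etaTransform_mem_slitDomain hμ (neg_exp_mem_slitDomain hζ))

theorem neg_exp_logEta (hμ : μ ≠ Measure.dirac 0) {ζ : ℂ} (hζ : ζ ∈ logStrip) :
    -Complex.exp (logEta μ ζ) = etaTransform μ (-Complex.exp ζ) :=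
  neg_exp_log_neg (etaTransform_mem_slitDomain hμ (neg_exp_mem_slitDomain hζ))

theorem logEta_conj (hμ : μ ≠ Measure.dirac 0) {ζ : ℂ} (hζ : ζ ∈ logStrip) :
    logEta μ ((starRingEnd ℂ) ζ) = (starRingEnd ℂ) (logEta μ ζ) := by
  have hz := neg_exp_mem_slitDomain hζ
  have h1 := Complex.mem_slitPlane_iff_arg.1
    (mem_slitDomain_iff.1 (etaTransform_mem_slitDomain hμ hz))
  rw [logEta, logEta, ← Complex.log_conj _ h1.1, Complex.exp_conj, ← map_neg,
    etaTransform_conj hμ hz, map_neg]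

/-- The argument bound for η_μ transported to the strip. Negative Im ζ corresponds to z in the upper
half-plane, and Im(η_μ(z) z̄) has the sign of the sine of Im h(ζ) - Im ζ, a number in (-π, π). -/
theorem logEta_im_mem_Ico (hμ : μ ≠ Measure.dirac 0) {ζ : ℂ} (hζ : ζ ∈ logStrip)
    (him : ζ.im < 0) : (logEta μ ζ).im ∈ Ico ζ.im 0 := by
  have hζ' := abs_lt.1 (show |ζ.im| < Real.pi from hζ)
  have hz : 0 < (-Complex.exp ζ).im := by
    rw [Complex.neg_im, Complex.exp_im, ← mul_neg]
    exact mul_pos (Real.exp_pos _) (neg_pos.2 (Real.sin_neg_of_neg_of_neg_pi_lt him hζ'.1))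
  have h1 := etaTransform_im_pos hμ hz
  have h2 := etaTransform_mul_conj_im_nonneg hμ hz
  have hlt : (logEta μ ζ).im < 0 := by
    rw [logEta, Complex.log_im, Complex.arg_neg_iff, Complex.neg_im]
    linarith
  refine ⟨?_, hlt⟩
  have hα := abs_lt.1 (show |(logEta μ ζ).im| < Real.pi from mapsTo_logEta hμ hζ)
  rw [← neg_exp_logEta hμ hζ, map_neg, neg_mul_neg, ← Complex.exp_conj, ← Complex.exp_add,
    Complex.exp_im, Complex.add_im, Complex.conj_im, ← sub_eq_add_neg] at h2
  by_contra hc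
  push Not at hc
  have := Real.sin_neg_of_neg_of_neg_pi_lt (sub_neg.2 hc) (by linarith)
  nlinarith [Real.exp_pos (logEta μ ζ + (starRingEnd ℂ) ζ).re]

theorem logEta_im_mem_uIcc (hμ : μ ≠ Measure.dirac 0) {ζ : ℂ} (hζ : ζ ∈ logStrip) :
    (logEta μ ζ).im ∈ uIcc 0 ζ.im := by
  rcases lt_trichotomy ζ.im 0 with h | h | h
  · rw [uIcc_of_ge h.le]
    exact Ico_subset_Icc_self (logEta_im_mem_Ico hμ hζ h)
  · have hreal : (starRingEnd ℂ) ζ = ζ := Complex.conj_eq_iff_im.2 h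
    have := logEta_conj hμ hζ
    rw [hreal, eq_comm, Complex.conj_eq_iff_im] at this
    rw [this]
    exact left_mem_uIcc
  · have hc : (starRingEnd ℂ) ζ ∈ logStrip := by
      simpa [logStrip] using hζ
    have := logEta_im_mem_Ico hμ hc (by simpa using h)
    rw [logEta_conj hμ hζ, Complex.conj_im, Complex.conj_im] at this
    rw [uIcc_of_le h.le]
    exact ⟨by linarith [this.2], by linarith [this.1]⟩

/-- On the real line Schwarz–Pick reads |h'| ≤ 1, since cos 0 = 1. This Lipschitz bound controls the
fixed point near -∞. -/
theorem logEta_re_sub_le (hμ : μ ≠ Measure.dirac 0) {a b : ℝ} (hab : a ≤ b) :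
    (logEta μ b).re - (logEta μ a).re ≤ b - a := by
  have hS : ∀ ζ ∈ Complex.im ⁻¹' {(0 : ℝ)}, ζ ∈ logStrip := by
    intro ζ hζ
    have : ζ.im = 0 := hζ
    simp [logStrip, this, Real.pi_pos]
  have hconv : Convex ℝ (Complex.im ⁻¹' {(0 : ℝ)}) :=
    (convex_singleton _).is_linear_preimage Complex.imLm.isLinear
  have h := hconv.norm_image_sub_le_of_norm_deriv_le (f := logEta μ) (C := 1) (x := a) (y := b)
    (fun ζ hζ => (differentiableOn_logEta hμ).differentiableAt (isOpen_logStrip.mem_nhds (hS ζ hζ)))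
    (fun ζ hζ => by
      have h1 := norm_deriv_mul_cos_le (differentiableOn_logEta hμ) (mapsTo_logEta hμ) (hS ζ hζ)
      have h0 : ζ.im = 0 := hζ
      rw [h0, zero_div, Real.cos_zero, mul_one] at h1
      exact h1.trans (Real.cos_le_one _))
    (by simp) (by simp)
  rw [one_mul, ← Complex.ofReal_sub, Complex.norm_real, Real.norm_of_nonneg (by linarith)] at h
  calc (logEta μ b).re - (logEta μ a).re = (logEta μ b - logEta μ a).re := by simp
    _ ≤ _ := Complex.re_le_norm _
    _ ≤ _ := h

variable {c : ℝ}

theorem iterate_averagedMap_logEta_im_mem (hμ : μ ≠ Measure.dirac 0) (hc0 : 0 ≤ c) (hc1 : c < 1)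
    {z : ℂ} (hz : z ∈ logStrip) (n : ℕ) :
    ((averagedMap (logEta μ) c z)^[n] z).im ∈ uIcc 0 z.im := by
  induction n with
  | zero => exact right_mem_uIcc
  | succ n ih =>
    rw [Function.iterate_succ_apply', averagedMap_im]
    have h1 := logEta_im_mem_uIcc hμ (iterate_averagedMap_mem (mapsTo_logEta hμ) hc0 hc1 hz hz n)
    exact convex_uIcc 0 z.im right_mem_uIcc (uIcc_subset_uIcc left_mem_uIcc ih h1)
      (sub_pos.2 hc1).le hc0 (by ring)

/-- The subordination function in the logarithmic coordinate. -/
theorem exists_logSubordination (hμ : μ ≠ Measure.dirac 0) (hc0 : 0 ≤ c) (hc1 : c < 1) :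
    ∃ W : ℂ → ℂ, DifferentiableOn ℂ W logStrip ∧ MapsTo W logStrip logStrip ∧
      (∀ z ∈ logStrip, W z = ((1 - c : ℝ) : ℂ) * z + (c : ℂ) * logEta μ (W z)) ∧
      ∀ z ∈ logStrip, (W z).im ∈ uIcc 0 z.im := by
  obtain ⟨W, h1, h2, h3, h4⟩ :=
    exists_fixedPoint_averagedMap (differentiableOn_logEta hμ) (mapsTo_logEta hμ) hc0 hc1
  refine ⟨W, h1, h2, fun z hz => (h3 z hz).symm, fun z hz => ?_⟩
  exact isClosed_Icc.mem_of_tendsto ((Complex.continuous_im.tendsto _).comp (h4 z hz))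
    (Eventually.of_forall fun n => iterate_averagedMap_logEta_im_mem hμ hc0 hc1 hz n)

theorem tendsto_logSubordination_atBot (hμ : μ ≠ Measure.dirac 0) (hc0 : 0 ≤ c) (hc1 : c < 1)
    {w : ℝ → ℝ} (hw : ∀ ξ, w ξ = (1 - c) * ξ + c * (logEta μ (w ξ)).re) :
    Tendsto w atBot atBot := by
  rw [tendsto_atBot]
  intro K
  -- If w(ξ) > K, the Lipschitz bound h(w) ≤ h(K) + w - K in the fixed point equation gives w ≤ ξ +
  -- c (h(K) - K) / (1 - c); the threshold on ξ is what makes this smaller than K.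
  filter_upwards [eventually_lt_atBot (K - c * ((logEta μ K).re - K) / (1 - c))] with ξ hξ
  by_contra hc
  push Not at hc
  have h1 := logEta_re_sub_le hμ hc.le
  have h2 := hw ξ
  have hc1' := sub_pos.2 hc1
  rw [lt_sub_iff_add_lt, ← lt_sub_iff_add_lt', div_lt_iff₀ hc1'] at hξ
  nlinarith [mul_le_mul_of_nonneg_left h1 hc0, mul_lt_mul_of_pos_left hc hc1']

end

/-! ### The measure μ_t and the proof of the theorem -/

/-- This is Re(m / (1 - g)) ≥ 0 with m = exp(ζ / 2) and g = -exp θ. Multiplying by the conjugate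
denominator leaves two exponentials with angles Im ζ / 2 and Im ζ / 2 - Im θ, both in [-π/2, π/2].
-/
theorem re_exp_half_div_nonneg {ζ θ : ℂ} (hζ : ζ ∈ logStrip) (hθ : θ.im ∈ uIcc 0 ζ.im) :
    0 ≤ (Complex.exp (ζ / 2) * (1 - -Complex.exp θ)⁻¹).re := by
  have hζ' := abs_lt.1 (show |ζ.im| < Real.pi from hζ)
  rw [sub_neg_eq_add, Complex.inv_def, ← mul_assoc, Complex.re_mul_ofReal]
  refine mul_nonneg ?_ (inv_nonneg.2 (Complex.normSq_nonneg _))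
  rw [map_add, map_one, mul_add, mul_one, ← Complex.exp_conj, ← Complex.exp_add, Complex.add_re]
  refine add_nonneg (exp_half_re_pos hζ).le ?_
  rw [Complex.exp_re]
  refine mul_nonneg (Real.exp_pos _).le (Real.cos_nonneg_of_mem_Icc ?_)
  have him : (ζ / 2 + (starRingEnd ℂ) θ).im = ζ.im / 2 - θ.im := by simp [sub_eq_add_neg]
  rw [him]
  rcases le_total 0 ζ.im with h | h
  · rw [uIcc_of_le h] at hθ
    exact ⟨by linarith [hθ.2], by linarith [hθ.1]⟩
  · rw [uIcc_of_ge h] at hθ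
    exact ⟨by linarith [hθ.2], by linarith [hθ.1]⟩

theorem eventually_exists_eq_of_tendsto_zero {g : ℝ → ℝ} (hg : ContinuousOn g (Iio 0))
    (hneg : ∀ x < 0, g x < 0) (hlim : Tendsto g (𝓝[<] 0) (𝓝 0)) :
    ∀ᶠ y in 𝓝[<] (0 : ℝ), ∃ x < 0, g x = y := by
  filter_upwards [Ioo_mem_nhdsLT (hneg (-1) (by norm_num))] with y hy
  obtain ⟨x', h1, h2⟩ := ((hlim.eventually (lt_mem_nhds hy.2)).and self_mem_nhdsWithin).exists
  obtain ⟨x, hx, hxy⟩ := isPreconnected_Iio.intermediate_value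
    (show (-1 : ℝ) ∈ Iio 0 by norm_num) h2 hg ⟨hy.1.le, h1.le⟩
  exact ⟨x, hx, hxy⟩

/-- A holomorphic self-map `ω` of the slit plane with `log(-ω(z)) = (1/t) log(-z) +
(1 - 1/t) log(-η_μ(ω(z)))`. -/
theorem exists_subordination {μ : Measure ℝ≥0} [IsProbabilityMeasure μ]
    (hμ : μ ≠ Measure.dirac 0) {t : ℝ} (ht : 1 ≤ t) :
    ∃ ω : ℂ → ℂ, DifferentiableOn ℂ ω slitDomain ∧ MapsTo ω slitDomain slitDomain ∧
      (∀ z ∈ slitDomain, (t : ℂ) * Complex.log (-ω z) =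
        Complex.log (-z) + ((t : ℂ) - 1) * Complex.log (-etaTransform μ (ω z))) ∧
      (∀ z ∈ slitDomain, (Complex.log (-etaTransform μ (ω z))).im ∈
        uIcc 0 (Complex.log (-z)).im) ∧
      (∀ x : ℝ, x < 0 → ∃ y : ℝ, y < 0 ∧ ω x = y) ∧
      Tendsto (fun x : ℝ => ω x) (𝓝[<] 0) (𝓝 0) ∧
      ∀ z : ℂ, 0 < z.im → (ω z).arg ∈ Ico z.arg Real.pi := by
  have ht0 : 0 < t := by linarith
  -- With this c one has t (1 - c) = 1 and t c = t - 1, so t times the fixed point equation is the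
  -- required logarithmic equation.
  set c : ℝ := 1 - 1 / t with hc
  have hc0 : 0 ≤ c := by
    rw [hc, sub_nonneg, div_le_one ht0]; exact ht
  have hc1 : c < 1 := by
    have : 0 < 1 / t := by positivity
    linarith
  have htc : t * (1 - c) = 1 := by rw [hc]; field_simp; ring
  obtain ⟨W, hWd, hWm, hWfix, hWim⟩ := exists_logSubordination hμ hc0 hc1
  set ω : ℂ → ℂ := fun z => -Complex.exp (W (Complex.log (-z))) with hω
  have hlog : ∀ z ∈ slitDomain, Complex.log (-ω z) = W (Complex.log (-z)) := fun z hz =>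
    log_neg_neg_exp (hWm (log_neg_mem_logStrip hz))
  have hreal : ∀ x : ℝ, x < 0 → W (Complex.log (-(x : ℂ))) = ((W (Real.log (-x) : ℝ)).re : ℝ) := by
    intro x hx
    have h1 := hWim _ (log_neg_mem_logStrip (ofReal_mem_slitDomain hx))
    rw [log_neg_ofReal hx, Complex.ofReal_im, uIcc_self] at h1
    rw [log_neg_ofReal hx]
    exact Complex.ext (by simp) (by simpa using h1)
  have hηim : ∀ z ∈ slitDomain,
      (logEta μ (W (Complex.log (-z)))).im ∈ uIcc 0 (W (Complex.log (-z))).im := fun z hz =>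
    logEta_im_mem_uIcc hμ (hWm (log_neg_mem_logStrip hz))
  refine ⟨ω, ?_, fun z hz => neg_exp_mem_slitDomain (hWm (log_neg_mem_logStrip hz)),
    fun z hz => ?_, fun z hz => ?_, fun x hx => ?_, ?_, fun z hz => ?_⟩
  · exact ((hWd.comp (differentiableOn_id.log_neg fun _ hz => hz)
      fun z hz => log_neg_mem_logStrip hz).cexp).neg
  · have h1 := hWfix _ (log_neg_mem_logStrip hz)
    have htc' : (t : ℂ) * (1 - (c : ℂ)) = 1 := by exact_mod_cast congrArg (fun r : ℝ => (r : ℂ)) htc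
    rw [hlog z hz]
    change _ = _ + ((t : ℂ) - 1) * logEta μ (W (Complex.log (-z)))
    push_cast at h1
    linear_combination (t : ℂ) * h1 +
      (Complex.log (-z) - logEta μ (W (Complex.log (-z)))) * htc'
  · exact uIcc_subset_uIcc left_mem_uIcc (hWim _ (log_neg_mem_logStrip hz)) (hηim z hz)
  · refine ⟨-Real.exp (W (Real.log (-x) : ℝ)).re, neg_neg_of_pos (Real.exp_pos _), ?_⟩
    simp only [hω, hreal x hx]
    push_cast
    rfl
  · have hlim : Tendsto (fun ξ : ℝ => (W ξ).re) atBot atBot := by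
      refine tendsto_logSubordination_atBot hμ hc0 hc1 fun ξ => ?_
      have hS : (ξ : ℂ) ∈ logStrip := by simp [logStrip, Real.pi_pos]
      have h1 := hWim _ hS
      rw [Complex.ofReal_im, uIcc_self] at h1
      have h2 : W ξ = ((W ξ).re : ℝ) := Complex.ext (by simp) (by simpa using h1)
      have h3 := congrArg Complex.re (hWfix _ hS)
      rw [Complex.add_re, Complex.re_ofReal_mul, Complex.re_ofReal_mul, Complex.ofReal_re] at h3
      rw [← h2]
      exact h3
    have h1 : Tendsto (fun x : ℝ => Real.log (-x)) (𝓝[<] 0) atBot := by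
      have : Tendsto (fun x : ℝ => -x) (𝓝[<] 0) (𝓝[>] 0) := by
        simpa using tendsto_neg_nhdsLT (a := (0 : ℝ))
      exact Real.tendsto_log_nhdsGT_zero.comp this
    have h2 := Real.tendsto_exp_atBot.comp (hlim.comp h1)
    have h3 := ((Complex.continuous_ofReal.tendsto 0).comp h2).neg
    simp only [Complex.ofReal_zero, neg_zero] at h3
    refine h3.congr' ?_
    filter_upwards [self_mem_nhdsWithin] with x hx
    simp only [hω, hreal x hx, Function.comp_apply, Complex.ofReal_exp]
  · have hzs := mem_slitDomain_of_im_ne_zero hz.ne'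
    have hζ := log_neg_mem_logStrip hzs
    have hzim : (Complex.log (-z)).im = z.arg - Real.pi := by
      rw [Complex.log_im, Complex.arg_neg_eq_arg_sub_pi_of_im_pos hz]
    have hargpi : z.arg < Real.pi := Complex.arg_lt_pi_iff.2 (Or.inr hz.ne')
    have h1 := hWim _ hζ
    have h2 := hηim z hzs
    rw [uIcc_of_ge (by linarith)] at h1
    rw [uIcc_of_ge h1.2] at h2
    have h3 := congrArg Complex.im (hWfix _ hζ)
    rw [Complex.add_im, Complex.im_ofReal_mul, Complex.im_ofReal_mul] at h3
    -- Strictness comes from the term (1 - c) log(-z), whose coefficient is positive; it gives arg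
    -- ω(z) < π.
    have h4 : (W (Complex.log (-z))).im < 0 := by
      have := mul_neg_of_pos_of_neg (sub_pos.2 hc1) (by linarith : (Complex.log (-z)).im < 0)
      nlinarith [mul_nonneg hc0 (neg_nonneg.2 h2.2)]
    have h5 : (W (Complex.log (-z))).im = (ω z).arg - Real.pi := by
      rw [← hlog z hzs, Complex.log_im, Complex.arg_neg_eq_arg_sub_pi_of_im_pos]
      simp only [hω, Complex.neg_im, Complex.exp_im]
      have := abs_lt.1 (show |(W (Complex.log (-z))).im| < Real.pi from hWm hζ)
      rw [← mul_neg]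
      exact mul_pos (Real.exp_pos _)
        (neg_pos.2 (Real.sin_neg_of_neg_of_neg_pi_lt h4 this.1))
    exact ⟨by linarith [h1.1], by linarith⟩

/-- A holomorphic `g` on the slit plane, real on the negative axis and vanishing at `0-`, such that
`log(-g(z))` has imaginary part between `0` and that of `log(-z)`, is an `η`-transform. -/
theorem exists_measure_etaTransform_eq {g : ℂ → ℂ} (hg : DifferentiableOn ℂ g slitDomain)
    (hm : MapsTo g slitDomain slitDomain)
    (him : ∀ z ∈ slitDomain, (Complex.log (-g z)).im ∈ uIcc 0 (Complex.log (-z)).im)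
    (hreal : ∀ x : ℝ, x < 0 → ∃ y : ℝ, y < 0 ∧ g x = y)
    (hlim : Tendsto (fun x : ℝ => g x) (𝓝[<] 0) (𝓝 0)) :
    ∃ ν : Measure ℝ≥0, IsProbabilityMeasure ν ∧ ν ≠ Measure.dirac 0 ∧
      ∀ z ∈ slitDomain, etaTransform ν z = g z := by
  have hne : ∀ z ∈ slitDomain, 1 - g z ≠ 0 := by
    intro z hz h0
    refine hm hz ?_
    rw [← sub_eq_zero.1 h0]
    simp
  have hf : DifferentiableOn ℂ (fun z => (1 - g z)⁻¹) slitDomain := (hg.const_sub 1).inv hne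
  have hf1 : Tendsto (fun x : ℝ => (1 - g x)⁻¹) (𝓝[<] 0) (𝓝 1) := by
    simpa using (hlim.const_sub 1).inv₀ (by simp)
  obtain ⟨ν, hν, hgeom⟩ := exists_probabilityMeasure_geomTransform hf
    (fun m hm0 => by
      have hz := neg_sq_mem_slitDomain hm0
      have hlogm := two_mul_log_mem_logStrip hm0
      have hm0' : m ≠ 0 := by rintro rfl; simp at hm0
      have h1 : Complex.log (-(-m ^ 2)) = 2 * Complex.log m := by
        have : -(-m ^ 2) = Complex.exp (2 * Complex.log m) := by
          rw [neg_neg, two_mul, Complex.exp_add, Complex.exp_log hm0', sq]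
        rw [this, log_exp_of_mem_logStrip hlogm]
      have h2 := him _ hz
      rw [h1] at h2
      have h3 := re_exp_half_div_nonneg hlogm h2
      rwa [mul_div_cancel_left₀ _ two_ne_zero, Complex.exp_log hm0',
        neg_exp_log_neg (hm hz)] at h3)
    (fun x hx => by
      obtain ⟨y, -, h⟩ := hreal x hx
      rw [h, ← Complex.ofReal_one, ← Complex.ofReal_sub, ← Complex.ofReal_inv, Complex.ofReal_im])
    hf1
  have heq := eqOn_slitDomain_of_eq_neg differentiableOn_geomTransform hf hgeom
  refine ⟨ν, hν, ?_, fun z hz => ?_⟩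
  -- For δ₀ the transform is constantly 1, which would force g(-1) = 0.
  · rintro rfl
    obtain ⟨y, hy, h⟩ := hreal (-1) (by norm_num)
    have h1 := hgeom (-1) (by norm_num)
    rw [h, geomTransform, integral_dirac, eq_comm, inv_eq_iff_eq_inv] at h1
    simp at h1
    exact hy.ne h1
  · have h1 : geomTransform ν z = (1 - g z)⁻¹ := heq hz
    have h2 := hne z hz
    have h3 : psiTransform ν z = (1 - g z)⁻¹ - 1 := by
      rw [← h1, ← one_add_psiTransform hz]; ring
    rw [etaTransform, one_add_psiTransform hz, h1, h3]
    field_simp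
    ring

/-- The functional equation for the inverses of `η` on `(-∞, 0)`. -/
theorem eventually_SigmaTransform_eq_rpow {μ ν : Measure ℝ≥0} [IsProbabilityMeasure μ]
    [IsProbabilityMeasure ν] (hμ : μ ≠ Measure.dirac 0) (hν : ν ≠ Measure.dirac 0) {t : ℝ}
    {ω : ℂ → ℂ} (hreal : ∀ x : ℝ, x < 0 → ∃ y : ℝ, y < 0 ∧ ω x = y)
    (hη : ∀ z ∈ slitDomain, etaTransform ν z = etaTransform μ (ω z))
    (hω : ∀ z ∈ slitDomain, (t : ℂ) * Complex.log (-ω z) =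
        Complex.log (-z) + ((t : ℂ) - 1) * Complex.log (-etaTransform μ (ω z))) :
    ∀ᶠ y : ℝ in 𝓝[<] 0, y ∈ etaRange μ ∧ y ∈ etaRange ν ∧
      SigmaTransform ν y = SigmaTransform μ y ^ t := by
  have hre : ∀ x : ℝ, x < 0 → etaTransform ν x = ((etaTransform ν x).re : ℝ) := by
    intro x hx
    obtain ⟨y, -, h⟩ := exists_etaTransform_ofReal hν hx
    rw [h, Complex.ofReal_re]
  have hcont : ContinuousOn (fun x : ℝ => (etaTransform ν x).re) (Iio 0) :=
    Complex.continuous_re.comp_continuousOn ((differentiableOn_etaTransform hν).continuousOn.comp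
      Complex.continuous_ofReal.continuousOn fun x hx => ofReal_mem_slitDomain hx)
  have hneg : ∀ x < (0 : ℝ), (etaTransform ν x).re < 0 := by
    intro x hx
    obtain ⟨y, hy, h⟩ := exists_etaTransform_ofReal hν hx
    rwa [h, Complex.ofReal_re]
  have hlim : Tendsto (fun x : ℝ => (etaTransform ν x).re) (𝓝[<] 0) (𝓝 0) := by
    simpa using! (Complex.continuous_re.tendsto _).comp (tendsto_etaTransform_zero hν)
  filter_upwards [eventually_exists_eq_of_tendsto_zero hcont hneg hlim, self_mem_nhdsWithin]
    with y ⟨x₀, hx₀, hxy₀⟩ hy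
  have hy : y < 0 := hy
  have hνy : ∃ x ∈ Iio (0 : ℝ), etaTransform ν (x : ℂ) = (y : ℂ) :=
    ⟨x₀, hx₀, by rw [hre x₀ hx₀, hxy₀]⟩
  have hx : etaInv ν y < 0 := Function.invFunOn_mem hνy
  have hxy : etaTransform ν (etaInv ν y : ℝ) = y := Function.invFunOn_eq hνy
  set x := etaInv ν y with hxdef
  obtain ⟨w, hw, hxw⟩ := hreal x hx
  have hxs := ofReal_mem_slitDomain hx
  -- As η_μ(ω(x)) = η_ν(x) = y, injectivity makes w = ω(x) the inverse value of η_μ at y. The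
  -- logarithmic equation at x then compares the logarithms of x / y and w / y.
  have hwy : etaTransform μ w = y := by rw [← hxw, ← hη _ hxs, hxy]
  have hμy : ∃ x ∈ Iio (0 : ℝ), etaTransform μ (x : ℂ) = (y : ℂ) := ⟨w, hw, hwy⟩
  have hinv : etaInv μ y = w :=
    injOn_etaTransform hμ (Function.invFunOn_mem hμy) hw
      ((Function.invFunOn_eq hμy).trans hwy.symm)
  refine ⟨⟨w, hw, hwy⟩, ⟨x, hx, hxy⟩, ?_⟩
  rw [SigmaTransform, SigmaTransform, hinv, ← hxdef]
  have h1 := hω _ hxs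
  rw [hxw, hwy, log_neg_ofReal hw, log_neg_ofReal hx, log_neg_ofReal hy] at h1
  have h2 : t * Real.log (-w) = Real.log (-x) + (t - 1) * Real.log (-y) := by exact_mod_cast h1
  have hdiv : ∀ a : ℝ, a < 0 → a / y = Real.exp (Real.log (-a) - Real.log (-y)) := by
    intro a ha
    rw [Real.exp_sub, Real.exp_log (by linarith), Real.exp_log (by linarith), neg_div_neg_eq]
  rw [hdiv x hx, hdiv w hw, ← Real.exp_mul]
  congr 1
  linarith

theorem mainTheorem11 (μ : Measure ℝ≥0) [IsProbabilityMeasure μ]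
    (hμ : μ ≠ Measure.dirac 0) (t : ℝ) (ht : 1 ≤ t) :
    ∃ (μt : Measure ℝ≥0) (ω : ℂ → ℂ),
      -- (1) the measure `μ_t`
      (IsProbabilityMeasure μt ∧ μt ≠ Measure.dirac 0 ∧
        ∀ᶠ y : ℝ in 𝓝[<] 0, y ∈ etaRange μ ∧ y ∈ etaRange μt ∧
          SigmaTransform μt y = SigmaTransform μ y ^ t) ∧
      -- (2) the analytic self-map `ω_t`
      (AnalyticOnNhd ℂ ω slitDomain ∧ MapsTo ω slitDomain slitDomain ∧
        (∀ x : ℝ, x < 0 → ∃ y : ℝ, y < 0 ∧ ω (x : ℂ) = (y : ℂ)) ∧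
        Tendsto (fun x : ℝ => ω (x : ℂ)) (𝓝[<] 0) (𝓝 0) ∧
        (∀ z : ℂ, 0 < z.im → (ω z).arg ∈ Set.Ico z.arg Real.pi) ∧
        ∀ z ∈ slitDomain, etaTransform μt z = etaTransform μ (ω z)) ∧
      -- (3) the formula for `ω_t`
      (∃ p : ℂ → ℂ, IsPositivePower (fun z => z / etaTransform μt z) (1 / t) p ∧
        ∀ z ∈ slitDomain, ω z = etaTransform μt z * p z) ∧
      -- (4) `ω_t` is a right inverse of `Φ_t`
      (∃ q Φ : ℂ → ℂ, IsPositivePower (fun z => z / etaTransform μ z) (t - 1) q ∧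
        (∀ z ∈ slitDomain, Φ z = z * q z) ∧
        AnalyticOnNhd ℂ Φ slitDomain ∧ (∀ z ∈ slitDomain, Φ z ≠ 0) ∧
        ∀ z ∈ slitDomain, Φ (ω z) = z) := by

  obtain ⟨ω, hωd, hωm, hωlog, hωim, hωreal, hωlim, hωarg⟩ := exists_subordination hμ ht
  have ht0 : (t : ℂ) ≠ 0 := by exact_mod_cast (by linarith : t ≠ 0)
  have hgreal : ∀ x : ℝ, x < 0 → ∃ y : ℝ, y < 0 ∧ etaTransform μ (ω x) = y := by
    intro x hx
    obtain ⟨y, hy, h⟩ := hωreal x hx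
    rw [h]
    exact exists_etaTransform_ofReal hμ hy
  have hglim : Tendsto (fun x : ℝ => etaTransform μ (ω x)) (𝓝[<] 0) (𝓝 0) := by
    have h1 : Tendsto (fun x : ℝ => (ω x).re) (𝓝[<] 0) (𝓝[<] 0) := by
      refine tendsto_nhdsWithin_iff.2
        ⟨by simpa using! (Complex.continuous_re.tendsto _).comp hωlim, ?_⟩
      filter_upwards [self_mem_nhdsWithin] with x hx
      obtain ⟨y, hy, h⟩ := hωreal x hx
      rwa [h, Complex.ofReal_re]
    refine ((tendsto_etaTransform_zero hμ).comp h1).congr' ?_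
    filter_upwards [self_mem_nhdsWithin] with x hx
    obtain ⟨y, hy, h⟩ := hωreal x hx
    rw [Function.comp_apply, h, Complex.ofReal_re]
  have hηm : MapsTo (etaTransform μ) slitDomain slitDomain := fun z hz =>
    etaTransform_mem_slitDomain hμ hz
  obtain ⟨ν, hν, hν0, hην⟩ := exists_measure_etaTransform_eq
    ((differentiableOn_etaTransform hμ).comp hωd hωm) (hηm.comp hωm) hωim hgreal hglim
  replace hην : ∀ z ∈ slitDomain, etaTransform ν z = etaTransform μ (ω z) := hην
  refine ⟨ν, ω, ⟨hν, hν0, eventually_SigmaTransform_eq_rpow hμ hν0 hωreal hην hωlog⟩,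
    ⟨hωd.analyticOnNhd isOpen_slitDomain, hωm, hωreal, hωlim, hωarg, hην⟩,
    ⟨_, isPositivePower_div (differentiableOn_etaTransform hν0)
      (fun z hz => etaTransform_mem_slitDomain hν0 hz)
      (fun x hx => exists_etaTransform_ofReal hν0 hx) (1 / t), fun z hz => ?_⟩,
    ⟨_, fun z => z * Complex.exp (((t - 1 : ℝ) : ℂ) *
      (Complex.log (-z) - Complex.log (-etaTransform μ z))),
      isPositivePower_div (differentiableOn_etaTransform hμ) hηm
        (fun x hx => exists_etaTransform_ofReal hμ hx) (t - 1), fun z _ => rfl, ?_, fun z hz => ?_,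
      fun z hz => ?_⟩⟩
  · rw [hην z hz]
    -- Once both sides are written as -exp of logarithms, the claim is the logarithmic equation
    -- divided by t.
    have h1 := hωlog z hz
    nth_rw 1 [← neg_exp_log_neg (hηm (hωm hz))]
    nth_rw 1 [← neg_exp_log_neg (hωm hz)]
    rw [neg_mul, ← Complex.exp_add]
    congr 2
    push_cast
    field_simp
    linear_combination h1
  · exact (differentiableOn_id.mul (((differentiableOn_id.log_neg fun _ hz => hz).sub
      ((differentiableOn_etaTransform hμ).log_neg hηm)).const_mul _).cexp).analyticOnNhd
      isOpen_slitDomain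
  · exact mul_ne_zero (ne_zero_of_mem_slitDomain hz) (Complex.exp_ne_zero _)
  · have h1 := hωlog z hz
    change ω z * Complex.exp (((t - 1 : ℝ) : ℂ) *
      (Complex.log (-ω z) - Complex.log (-etaTransform μ (ω z)))) = z
    conv_rhs => rw [← neg_exp_log_neg hz]
    nth_rw 1 [← neg_exp_log_neg (hωm hz)]
    rw [neg_mul, ← Complex.exp_add]
    congr 2
    push_cast
    linear_combination h1
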